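/- Let $a>1$ be an integer and let $\mu$ be a finitely supported probability measure on $\mathbf Z$ with $\gcd(\operatorname{supp}\mu-\operatorname{supp}\mu)=1$, i.e. $\mu$ is not supported on a coset of a proper subgroup of $\mathbf Z$. Let $X_0=0$ and $X_{n+1}=aX_n+b_n$, where the $b_n$ are independent with law $\mu$, and let $\mu_n$ be the law of $X_n$. For a positive integer $q$ let $u_q$ be the uniform measure on $\mathbf Z/q\mathbf Z$, and let $\|\cdot\|$ be the $\ell^1$ norm (so that $\frac12\|\cdot\|$ is the total variation distance between probability measures). Put $H(\nu)=\sum_x\nu(\{x\})\log\nu(\{x\})^{-1}$. Then the limit $H=H(a,\mu)=\lim_{n\to\infty}\frac1nH(\mu_n)$ (the entropy rate) exists, and the following hold for every $\delta>0$. (i) $\frac12\|\mu_n\bmod q-u_q\|=1-o(1)$ as $q\to\infty$, uniformly over all integers $n\ge0$ with $Hn\le(1-\delta)\log q$. That is, for every $\varepsilon>0$ there is $q_0$ such that $\left|\frac12\|\mu_n\bmod q-u_q\|-1\right|\le\varepsilon$ whenever $q\ge q_0$ and $Hn\le(1-\delta)\log q$. (ii) Assume $H>\frac12\log a$. Then,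 as $n\to\infty$, for a proportion $1-o(1)$ of the primes $q$ with $\log q\le(1-\delta)Hn$ we have $\|\mu_n\bmod q-u_q\|=o(1)$. That is, for all $\varepsilon,\eta>0$ and all sufficiently large $n$, at least $(1-\eta)$ times the number of primes $q$ with $\log q\le(1-\delta)Hn$ satisfy $\|\mu_n\bmod q-u_q\|\le\varepsilon$. The same holds with "primes $q$" replaced by "composite integers $q$ with $\gcd(q,a)=1$". Here $o(1)$ and the thresholds may depend on $a$, $\mu$ and $\delta$ (and on $\varepsilon,\eta$ where these appear). -/

import Mathlib

open Filter Topology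

namespace CDG

/-- The law of `X n`, where `X 0 = 0` and `X (n + 1) = a * X n + b n`, the steps `b n` being
independent with distribution `μ`. -/
noncomputable def walkLaw (a : ℕ) (μ : PMF ℤ) : ℕ → PMF ℤ
  | 0 => PMF.pure 0
  | n + 1 => (walkLaw a μ n).bind fun x => μ.map fun b => (a : ℤ) * x + b

/-- Shannon entropy `∑ x, p x * log (1 / p x)` with the natural logarithm. It is only used for
finitely supported `p`, for which the sum is finite. -/
noncomputable def entropy (p : PMF ℤ) : ℝ :=
  ∑' x : ℤ, Real.negMulLog (p x).toReal

/-- The entropy rate: the limit of `entropy (walkLaw a μ n) / n` as `n` tends to infinity. -/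
noncomputable def entropyRate (a : ℕ) (μ : PMF ℤ) : ℝ :=
  limUnder atTop fun n : ℕ => entropy (walkLaw a μ n) / n

/-- The `l¹` distance, with values in `[0, 2]`, between the reduction of `p` modulo `q` and the
uniform distribution on `ℤ/qℤ`, for `q ≥ 1`. -/
noncomputable def distUniform (p : PMF ℤ) (q : ℕ) : ℝ :=
  ∑' x : ZMod q, |((p.map fun k : ℤ => (k : ZMod q)) x).toReal - 1 / (q : ℝ)|

/-- The primes `q` with `log q ≤ t`. -/
def primesUpTo (t : ℝ) : Set ℕ :=
  {q | q.Prime ∧ Real.log q ≤ t}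

/-- The composite `q` coprime to `a` with `log q ≤ t`. -/
def coprimeCompositesUpTo (a : ℕ) (t : ℝ) : Set ℕ :=
  {q | 1 < q ∧ ¬ q.Prime ∧ q.Coprime a ∧ Real.log q ≤ t}

end CDG

/-! By `walkLaw_add`, the variable X_n has the law of ∑_{i<n} a^i b_i with independent digits b_i,
so lengthening the walk adds a digit at the top place; `IsDigitWalk` records this, with p_n the
density. The power sums ∑ p_n(x)^t are submultiplicative in n for t ≤ 1, and for t ≥ 1 up to the
factor (2L+1)^(t-1), because x = a^m y + z has at most 2L+1 solutions with z in the range of X_m.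
Their derivative at t = 1 is minus the entropy. Hence entropy is subadditive and the rate H exists,
and Chernoff's method gives exp(-(H+ε)n) ≤ p_n(X_n) ≤ exp(-(H-ε)n) outside an event of exponentially
small probability (`exists_massOn_small_le`, `exists_massOn_large_le`).

For (i), almost all the mass of X_n lies on at most exp((H+ε)n) = o(q) integers, so its reduction
misses almost all of ℤ/qℤ.

For (ii), Parseval and Cauchy–Schwarz bound the distance to uniform by the energy ∑_{r≠0} |ĝ(r/q)|²
of a submeasure g of almost full mass (`distUniform_le`), and the energy is controlled on average
over q. Take for g the walk killed when p_m(x) > exp(-Em), with E slightly below H. For denominators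
up to D, apply the large sieve at the time m ≈ 2 log_a D when the walk has range about D²: the
energy is at most a constant times D² exp(-Em) ≈ D^(2-2E/log a), and this is at most D^(1-c)
precisely because H > (1/2) log a leaves room for 2E ≥ (1+c) log a. If that m is beyond the last
killing time N, use N instead; log D ≤ (1-δ)Hn then suffices. Energy is convex and translation
invariant, so the bound survives until time n (`energy_le_of_le_killedWalk`), and one g serves all
D.

For primes, D^(1-c) is negligible against the number of primes. For composites, the energy modulo q
is spread over the divisors d > 1 of q. Large d are negligible by partial summation. For the
boundedly many small d, the last K steps are left unkilled, and each contracts ĝ(r/d) by a fixed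
factor κ < 1, because the digit differences have gcd 1 and d is coprime to a. -/

namespace CDG

/-! ### The additive character of ℝ/ℤ -/

/-- The character `t ↦ exp (2πit)` of `ℝ/ℤ`. -/
noncomputable def expCircle (t : ℝ) : ℂ := Complex.exp ((2 * Real.pi * t : ℝ) * Complex.I)

lemma norm_expCircle (t : ℝ) : ‖expCircle t‖ = 1 := Complex.norm_exp_ofReal_mul_I _

lemma expCircle_add (s t : ℝ) : expCircle (s + t) = expCircle s * expCircle t := by
  rw [expCircle, expCircle, expCircle, ← Complex.exp_add]
  congr 1
  push_cast
  ring

lemma expCircle_zero : expCircle 0 = 1 := by simp [expCircle]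

lemma expCircle_int (k : ℤ) : expCircle k = 1 := by
  rw [expCircle, Complex.exp_eq_one_iff]
  exact ⟨k, by push_cast; ring⟩

lemma expCircle_neg (t : ℝ) : expCircle (-t) = (starRingEnd ℂ) (expCircle t) := by
  rw [expCircle, expCircle, ← Complex.exp_conj]
  congr 1
  rw [map_mul, Complex.conj_I, Complex.conj_ofReal]
  push_cast
  ring

lemma expCircle_natCast_mul (n : ℕ) (t : ℝ) : expCircle (n * t) = expCircle t ^ n := by
  rw [expCircle, expCircle, ← Complex.exp_nat_mul]
  congr 1
  push_cast
  ring

lemma expCircle_add_int (t : ℝ) (k : ℤ) : expCircle (t + k) = expCircle t := by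
  rw [expCircle_add, expCircle_int, mul_one]

lemma expCircle_eq_one_iff (t : ℝ) : expCircle t = 1 ↔ ∃ k : ℤ, t = k := by
  rw [expCircle, Complex.exp_eq_one_iff]
  constructor
  · rintro ⟨n, hn⟩
    refine ⟨n, ?_⟩
    have h : ((2 * Real.pi * t : ℝ) : ℂ) * Complex.I = ((2 * Real.pi * n : ℝ) : ℂ) * Complex.I := by
      rw [hn]; push_cast; ring
    have h2 := mul_right_cancel₀ Complex.I_ne_zero h
    have h3 : 2 * Real.pi * t = 2 * Real.pi * n := by exact_mod_cast h2
    have : (2 * Real.pi) ≠ 0 := by positivity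
    exact mul_left_cancel₀ this h3
  · rintro ⟨k, rfl⟩
    exact ⟨k, by push_cast; ring⟩

lemma norm_expCircle_sub_one (t : ℝ) : ‖expCircle t - 1‖ = 2 * |Real.sin (Real.pi * t)| := by
  have h := Complex.norm_exp_I_mul_ofReal_sub_one (2 * Real.pi * t)
  rw [expCircle, mul_comm, h, norm_mul, Real.norm_eq_abs, Real.norm_eq_abs]
  rw [abs_of_pos (by norm_num : (0 : ℝ) < 2)]
  congr 3
  ring

lemma four_mul_le_norm_expCircle_sub_one {t : ℝ} (h0 : 0 ≤ t) (h1 : t ≤ 1 / 2) :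
    4 * t ≤ ‖expCircle t - 1‖ := by
  rw [norm_expCircle_sub_one]
  have h := Real.mul_le_sin (x := Real.pi * t) (by positivity)
    (by nlinarith [Real.pi_pos])
  have h2 : 2 / Real.pi * (Real.pi * t) = 2 * t := by field_simp
  have := le_abs_self (Real.sin (Real.pi * t))
  linarith

/-! ### Dirichlet kernels and the large sieve inequality -/

/-- The Dirichlet kernel `∑ u < n, exp (2πiut)`. -/
noncomputable def dirichletKernel (n : ℕ) (t : ℝ) : ℂ := ∑ u ∈ Finset.range n, expCircle (u * t)

lemma dirichletKernel_add_int (n : ℕ) (t : ℝ) (k : ℤ) :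
    dirichletKernel n (t + k) = dirichletKernel n t := by
  refine Finset.sum_congr rfl fun u _ => ?_
  rw [mul_add]
  have := expCircle_add_int (u * t) ((u : ℤ) * k)
  push_cast at this
  exact this

lemma dirichletKernel_neg (n : ℕ) (t : ℝ) :
    dirichletKernel n (-t) = (starRingEnd ℂ) (dirichletKernel n t) := by
  rw [dirichletKernel, dirichletKernel, map_sum]
  refine Finset.sum_congr rfl fun u _ => ?_
  rw [mul_neg, expCircle_neg]

lemma norm_dirichletKernel_le (n : ℕ) (t : ℝ) : ‖dirichletKernel n t‖ ≤ n := by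
  refine (norm_sum_le _ _).trans ?_
  simp [norm_expCircle]

lemma norm_dirichletKernel_mul_le (n : ℕ) {t : ℝ} (h0 : 0 ≤ t) (h1 : t ≤ 1 / 2) :
    ‖dirichletKernel n t‖ * (2 * t) ≤ 1 := by
  have h : dirichletKernel n t * (expCircle t - 1) = expCircle t ^ n - 1 := by
    rw [← geom_sum_mul]
    simp only [dirichletKernel, expCircle_natCast_mul]
  have h2 : ‖dirichletKernel n t‖ * ‖expCircle t - 1‖ ≤ 2 := by
    rw [← norm_mul, h]
    refine (norm_sub_le _ _).trans ?_
    simp [norm_expCircle]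
    norm_num
  have := four_mul_le_norm_expCircle_sub_one h0 h1
  nlinarith [norm_nonneg (dirichletKernel n t)]

lemma sum_range_inv_sq_le (n : ℕ) :
    ∑ i ∈ Finset.range n, 1 / ((i : ℝ) + 1) ^ 2 ≤ 2 - 1 / (n : ℝ) := by
  induction n with
  | zero => simp
  | succ n ih =>
    rw [Finset.sum_range_succ]
    rcases Nat.eq_zero_or_pos n with rfl | hn
    · norm_num
    · have hn' : (0 : ℝ) < n := by exact_mod_cast hn
      have h : 1 / ((n : ℝ) + 1) ^ 2 ≤ 1 / n - 1 / (n + 1) := by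
        rw [div_sub_div _ _ hn'.ne' (by positivity), div_le_div_iff₀ (by positivity) (by positivity)]
        nlinarith
      push_cast
      linarith

/-- A majorant of the squared Dirichlet kernel at distance at least `i / M` from the integers. -/
noncomputable def kernelMajorant (W M i : ℕ) : ℝ :=
  if i = 0 then 4 * (W : ℝ) ^ 2 else (M : ℝ) ^ 2 / (4 * (i : ℝ) ^ 2)

lemma kernelMajorant_nonneg (W M i : ℕ) : 0 ≤ kernelMajorant W M i := by
  rw [kernelMajorant]; split_ifs <;> positivity

lemma sum_kernelMajorant_le (W M : ℕ) :
    ∑ i ∈ Finset.range M, kernelMajorant W M i ≤ 4 * (W : ℝ) ^ 2 + (M : ℝ) ^ 2 / 2 := by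
  cases M with
  | zero => simp
  | succ M =>
    rw [Finset.sum_range_succ']
    have h1 : ∀ i ∈ Finset.range M, kernelMajorant W (M + 1) (i + 1) =
        ((M + 1 : ℕ) : ℝ) ^ 2 / 4 * (1 / ((i : ℝ) + 1) ^ 2) := by
      intro i _
      rw [kernelMajorant, if_neg (Nat.succ_ne_zero i)]
      push_cast
      field_simp
    rw [Finset.sum_congr rfl h1, ← Finset.mul_sum]
    have h2 := sum_range_inv_sq_le M
    have h3 : (0 : ℝ) ≤ 1 / (M : ℝ) := by positivity
    have h4 : ∑ i ∈ Finset.range M, 1 / ((i : ℝ) + 1) ^ 2 ≤ 2 := by linarith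
    have h5 := mul_le_mul_of_nonneg_left h4 (by positivity : (0 : ℝ) ≤ ((M + 1 : ℕ) : ℝ) ^ 2 / 4)
    have h6 : kernelMajorant W (M + 1) 0 = 4 * (W : ℝ) ^ 2 := by simp [kernelMajorant]
    rw [h6]
    linarith

lemma norm_sq_dirichletKernel_le_kernelMajorant (W M i : ℕ) {t : ℝ} (hi : (i : ℝ) ≤ M * t)
    (hM : 0 < M) (h1 : t ≤ 1 / 2) : ‖dirichletKernel (2 * W) t‖ ^ 2 ≤ kernelMajorant W M i := by
  have hM' : (0 : ℝ) < M := by exact_mod_cast hM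
  rw [kernelMajorant]
  split_ifs with h
  · have := norm_dirichletKernel_le (2 * W) t
    push_cast at this
    nlinarith [norm_nonneg (dirichletKernel (2 * W) t)]
  · have hi0 : (0 : ℝ) < i := by exact_mod_cast Nat.pos_of_ne_zero h
    have ht : 0 ≤ t := by
      by_contra hlt
      push Not at hlt
      nlinarith
    have h2 := norm_dirichletKernel_mul_le (2 * W) ht h1
    set x := ‖dirichletKernel (2 * W) t‖ with hx
    have hx0 : 0 ≤ x := norm_nonneg _
    have h3 : x * (2 * i) ≤ M := by
      calc x * (2 * i) ≤ x * (2 * (M * t)) := by gcongr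
        _ = M * (x * (2 * t)) := by ring
        _ ≤ M * 1 := by gcongr
        _ = M := mul_one _
    rw [le_div_iff₀ (by positivity)]
    calc x ^ 2 * (4 * (i : ℝ) ^ 2) = (x * (2 * i)) ^ 2 := by ring
      _ ≤ (M : ℝ) ^ 2 := by gcongr

/-- Cut the circle into M cells of length 1/M. Separation puts at most one point in each cell, and a
point in cell j is at distance at least j/M or (M-1-j)/M from the integers, according to its half of
the circle. Summing the majorant over all cells from both ends gives 2(4W² + M²/2) ≤ 9W². -/
lemma sum_norm_sq_dirichletKernel_le {ι : Type*} (s : Finset ι) (θ : ι → ℝ) (W M : ℕ)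
    (hM : 0 < M) (hMW : M ≤ W)
    (hsep : ∀ p ∈ s, ∀ p' ∈ s, p ≠ p' → ∀ k : ℤ, 1 / (M : ℝ) ≤ |θ p - θ p' - k|) (t : ℝ) :
    ∑ p ∈ s, ‖dirichletKernel (2 * W) (θ p - t)‖ ^ 2 ≤ 9 * (W : ℝ) ^ 2 := by
  classical
  have hM' : (0 : ℝ) < M := by exact_mod_cast hM
  have hMW' : (M : ℝ) ≤ W := by exact_mod_cast hMW
  set τ : ι → ℝ := fun p => Int.fract (θ p - t) with hτ
  set j : ι → ℕ := fun p => ⌊M * τ p⌋₊ with hj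
  have hτ0 : ∀ p, 0 ≤ τ p := fun p => Int.fract_nonneg _
  have hτ1 : ∀ p, τ p < 1 := fun p => Int.fract_lt_one _
  have hj0 : ∀ p, (j p : ℝ) ≤ M * τ p := fun p => Nat.floor_le (mul_nonneg hM'.le (hτ0 p))
  have hj1 : ∀ p, M * τ p < j p + 1 := fun p => Nat.lt_floor_add_one _
  have hjM : ∀ p, j p < M := by
    intro p
    have : (j p : ℝ) < M := (hj0 p).trans_lt (by nlinarith [hτ1 p])
    exact_mod_cast this
  have hinj : Set.InjOn j s := by
    intro p hp p' hp' hpp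
    by_contra hne
    have h := hsep p hp p' hp' hne (⌊θ p - t⌋ - ⌊θ p' - t⌋)
    have h1 : θ p - θ p' - ((⌊θ p - t⌋ - ⌊θ p' - t⌋ : ℤ) : ℝ) = τ p - τ p' := by
      simp only [hτ, Int.fract]
      push_cast
      ring
    rw [h1, div_le_iff₀ hM'] at h
    have h2 : |τ p - τ p'| * M < 1 := by
      rw [← abs_of_pos hM', ← abs_mul, abs_lt]
      have a1 := hj0 p
      have a2 := hj1 p
      have a3 := hj0 p'
      have a4 := hj1 p'
      rw [hpp] at a1 a2
      constructor <;> nlinarith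
    linarith
  have hb : ∀ p ∈ s, ‖dirichletKernel (2 * W) (θ p - t)‖ ^ 2 ≤
      kernelMajorant W M (j p) + kernelMajorant W M (M - 1 - j p) := by
    intro p _
    have he : dirichletKernel (2 * W) (θ p - t) = dirichletKernel (2 * W) (τ p) := by
      have := dirichletKernel_add_int (2 * W) (τ p) ⌊θ p - t⌋
      rwa [hτ, Int.fract_add_floor] at this
    rw [he]
    rcases le_or_gt (τ p) (1 / 2) with h | h
    · have := norm_sq_dirichletKernel_le_kernelMajorant W M (j p) (hj0 p) hM h
      linarith [kernelMajorant_nonneg W M (M - 1 - j p)]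
    · have he2 : ‖dirichletKernel (2 * W) (τ p)‖ = ‖dirichletKernel (2 * W) (1 - τ p)‖ := by
        have h1 := dirichletKernel_add_int (2 * W) (-τ p) 1
        rw [dirichletKernel_neg] at h1
        have h2 : 1 - τ p = -τ p + ((1 : ℤ) : ℝ) := by push_cast; ring
        rw [h2, h1, Complex.norm_conj]
      rw [he2]
      have := norm_sq_dirichletKernel_le_kernelMajorant W M (M - 1 - j p) (t := 1 - τ p) (by
        have := hjM p
        have h3 : ((M - 1 - j p : ℕ) : ℝ) = M - 1 - j p := by
          rw [Nat.cast_sub (by omega), Nat.cast_sub (by omega)]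
          simp
        rw [h3]
        linarith [hj1 p]) hM (by linarith)
      linarith [kernelMajorant_nonneg W M (j p)]
  refine (Finset.sum_le_sum hb).trans ?_
  have hsum : ∑ p ∈ s, (kernelMajorant W M (j p) + kernelMajorant W M (M - 1 - j p)) ≤
      ∑ i ∈ Finset.range M, (kernelMajorant W M i + kernelMajorant W M (M - 1 - i)) := by
    rw [← Finset.sum_image (f := fun i => kernelMajorant W M i + kernelMajorant W M (M - 1 - i))
      (g := j) hinj]
    refine Finset.sum_le_sum_of_subset_of_nonneg ?_ fun i _ _ =>
      add_nonneg (kernelMajorant_nonneg _ _ _) (kernelMajorant_nonneg _ _ _)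
    intro i hi
    obtain ⟨p, _, rfl⟩ := Finset.mem_image.1 hi
    exact Finset.mem_range.2 (hjM p)
  refine hsum.trans ?_
  rw [Finset.sum_add_distrib, Finset.sum_range_reflect]
  have := sum_kernelMajorant_le W M
  nlinarith

/-- Each k in [-W, W] is a difference u - v in at least W ways, namely u = i + k⁺ and v = i + k⁻
with i < W. Passing to differences turns the sharp cutoff in k into squared Dirichlet kernels, which
have absolutely bounded row sums. -/
lemma mul_sum_Icc_le_sum_sub {φ : ℤ → ℝ} (hφ : ∀ k, 0 ≤ φ k) (W : ℕ) :
    W * ∑ k ∈ Finset.Icc (-W : ℤ) W, φ k ≤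
      ∑ u ∈ Finset.range (2 * W), ∑ v ∈ Finset.range (2 * W), φ ((u : ℤ) - v) := by
  rw [← Finset.sum_product']
  have h1 : W * ∑ k ∈ Finset.Icc (-W : ℤ) W, φ k =
      ∑ x ∈ Finset.Icc (-W : ℤ) W ×ˢ Finset.range W, φ x.1 := by
    rw [Finset.sum_product, Finset.mul_sum]
    simp
  set g : ℤ × ℕ → ℕ × ℕ := fun x => (x.2 + x.1.toNat, x.2 + (-x.1).toNat) with hg
  have h2 : ∀ x ∈ Finset.Icc (-W : ℤ) W ×ˢ Finset.range W,
      φ x.1 = φ (((g x).1 : ℤ) - (g x).2) := by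
    intro x _
    congr 1
    simp only [hg]
    push_cast
    omega
  have hinj : Set.InjOn g (Finset.Icc (-W : ℤ) W ×ˢ Finset.range W : Finset (ℤ × ℕ)) := by
    rintro ⟨k, i⟩ _ ⟨k', i'⟩ _ h
    simp only [hg, Prod.mk.injEq] at h ⊢
    omega
  rw [h1, Finset.sum_congr rfl h2,
    ← Finset.sum_image (f := fun y : ℕ × ℕ => φ ((y.1 : ℤ) - y.2)) hinj]
  refine Finset.sum_le_sum_of_subset_of_nonneg ?_ fun y _ _ => hφ _
  intro y hy
  obtain ⟨⟨k, i⟩, hx, rfl⟩ := Finset.mem_image.1 hy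
  simp only [Finset.mem_product, Finset.mem_Icc, Finset.mem_range, hg] at hx ⊢
  omega

/-- The dual form of the large sieve. After smoothing, the left side is at most a quadratic form in
c with kernel |K(θ_p - θ_p')|², and Schur's test with the row sums 9W² bounds it. -/
lemma sum_norm_sq_trigPoly_le {ι : Type*} (s : Finset ι) (θ : ι → ℝ) (W M : ℕ)
    (hM : 0 < M) (hMW : M ≤ W)
    (hsep : ∀ p ∈ s, ∀ p' ∈ s, p ≠ p' → ∀ k : ℤ, 1 / (M : ℝ) ≤ |θ p - θ p' - k|) (c : ι → ℂ) :
    ∑ k ∈ Finset.Icc (-W : ℤ) W, ‖∑ p ∈ s, c p * expCircle (k * θ p)‖ ^ 2 ≤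
      9 * W * ∑ p ∈ s, ‖c p‖ ^ 2 := by
  have hW : (0 : ℝ) < W := by exact_mod_cast lt_of_lt_of_le hM hMW
  set F : ℤ → ℂ := fun k => ∑ p ∈ s, c p * expCircle (k * θ p) with hF
  set K : ℝ → ℂ := dirichletKernel (2 * W) with hK
  have h1 := mul_sum_Icc_le_sum_sub (φ := fun k => ‖F k‖ ^ 2) (fun k => by positivity) W
  have h2 : ((∑ u ∈ Finset.range (2 * W), ∑ v ∈ Finset.range (2 * W),
      ‖F ((u : ℤ) - v)‖ ^ 2 : ℝ) : ℂ) = ∑ p ∈ s, ∑ p' ∈ s,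
        c p * (starRingEnd ℂ) (c p') * (K (θ p - θ p') * (starRingEnd ℂ) (K (θ p - θ p'))) := by
    have e1 : ∀ u v : ℕ, ((‖F ((u : ℤ) - v)‖ ^ 2 : ℝ) : ℂ) = ∑ p ∈ s, ∑ p' ∈ s,
        c p * (starRingEnd ℂ) (c p') * (expCircle (u * (θ p - θ p')) *
          (starRingEnd ℂ) (expCircle (v * (θ p - θ p')))) := by
      intro u v
      push_cast
      rw [← Complex.mul_conj', hF]
      simp only [map_sum, map_mul]
      rw [Finset.sum_mul_sum]
      refine Finset.sum_congr rfl fun p _ => Finset.sum_congr rfl fun p' _ => ?_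
      rw [mul_mul_mul_comm, ← expCircle_neg, ← expCircle_neg, ← expCircle_add, ← expCircle_add]
      congr 2
      push_cast
      ring
    simp only [Complex.ofReal_sum, e1]
    have e2 : ∀ u : ℕ, ∑ v ∈ Finset.range (2 * W), ∑ p ∈ s, ∑ p' ∈ s,
        c p * (starRingEnd ℂ) (c p') * (expCircle (u * (θ p - θ p')) *
          (starRingEnd ℂ) (expCircle (v * (θ p - θ p')))) = ∑ p ∈ s, ∑ p' ∈ s,
        c p * (starRingEnd ℂ) (c p') * (expCircle (u * (θ p - θ p')) *
          (starRingEnd ℂ) (K (θ p - θ p'))) := by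
      intro u
      rw [Finset.sum_comm]
      refine Finset.sum_congr rfl fun p _ => ?_
      rw [Finset.sum_comm]
      refine Finset.sum_congr rfl fun p' _ => ?_
      rw [hK, dirichletKernel, map_sum, Finset.mul_sum, Finset.mul_sum]
    simp only [e2]
    rw [Finset.sum_comm]
    refine Finset.sum_congr rfl fun p _ => ?_
    rw [Finset.sum_comm]
    refine Finset.sum_congr rfl fun p' _ => ?_
    rw [← Finset.mul_sum, ← Finset.sum_mul]
    rfl
  have h3 : ∑ u ∈ Finset.range (2 * W), ∑ v ∈ Finset.range (2 * W),
      ‖F ((u : ℤ) - v)‖ ^ 2 ≤ ∑ p ∈ s, ∑ p' ∈ s, ‖c p‖ * ‖c p'‖ * ‖K (θ p - θ p')‖ ^ 2 := by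
    have hnn : 0 ≤ ∑ u ∈ Finset.range (2 * W), ∑ v ∈ Finset.range (2 * W),
      ‖F ((u : ℤ) - v)‖ ^ 2 := by positivity
    rw [← abs_of_nonneg hnn, ← Real.norm_eq_abs, ← Complex.norm_real, h2]
    refine (norm_sum_le _ _).trans (Finset.sum_le_sum fun p _ => (norm_sum_le _ _).trans
      (Finset.sum_le_sum fun p' _ => le_of_eq ?_))
    simp only [norm_mul, Complex.norm_conj]
    ring
  have hrow : ∀ t : ℝ, ∑ p ∈ s, ‖K (θ p - t)‖ ^ 2 ≤ 9 * (W : ℝ) ^ 2 := fun t =>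
    sum_norm_sq_dirichletKernel_le s θ W M hM hMW hsep t
  have hsymm : ∀ t : ℝ, ‖K (-t)‖ = ‖K t‖ := by
    intro t
    rw [hK, dirichletKernel_neg, Complex.norm_conj]
  have h4 : ∑ p ∈ s, ∑ p' ∈ s, ‖c p‖ * ‖c p'‖ * ‖K (θ p - θ p')‖ ^ 2 ≤
      9 * (W : ℝ) ^ 2 * ∑ p ∈ s, ‖c p‖ ^ 2 := by
    -- Schur's test: ‖c p‖‖c p'‖ ≤ (‖c p‖² + ‖c p'‖²)/2, and the kernel is symmetric.
    have h5 : ∑ p ∈ s, ∑ p' ∈ s, ‖c p‖ * ‖c p'‖ * ‖K (θ p - θ p')‖ ^ 2 ≤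
        ∑ p ∈ s, ∑ p' ∈ s, (‖c p‖ ^ 2 / 2 * ‖K (θ p' - θ p)‖ ^ 2 +
          ‖c p'‖ ^ 2 / 2 * ‖K (θ p - θ p')‖ ^ 2) := by
      refine Finset.sum_le_sum fun p _ => Finset.sum_le_sum fun p' _ => ?_
      rw [← neg_sub (θ p) (θ p'), hsymm, ← add_mul]
      refine mul_le_mul_of_nonneg_right ?_ (by positivity)
      nlinarith [sq_nonneg (‖c p‖ - ‖c p'‖)]
    refine h5.trans ?_
    simp only [Finset.sum_add_distrib]
    rw [Finset.sum_comm (f := fun p p' => ‖c p'‖ ^ 2 / 2 * ‖K (θ p - θ p')‖ ^ 2)]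
    simp only [← Finset.mul_sum]
    have h6 : ∑ p ∈ s, ‖c p‖ ^ 2 / 2 * ∑ p' ∈ s, ‖K (θ p' - θ p)‖ ^ 2 ≤
        ∑ p ∈ s, ‖c p‖ ^ 2 / 2 * (9 * (W : ℝ) ^ 2) :=
      Finset.sum_le_sum fun p _ => mul_le_mul_of_nonneg_left (hrow _) (by positivity)
    rw [← Finset.sum_mul, ← Finset.sum_div] at h6
    linarith
  have h7 := (h1.trans h3).trans h4
  have h8 : (W : ℝ) * ∑ k ∈ Finset.Icc (-W : ℤ) W, ‖F k‖ ^ 2 ≤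
      W * (9 * W * ∑ p ∈ s, ‖c p‖ ^ 2) := by
    refine h7.trans (le_of_eq ?_)
    ring
  exact le_of_mul_le_mul_left h8 hW

/-- The large sieve inequality for `1 / M`-separated points modulo `1`. -/
theorem large_sieve_of_separated {ι : Type*} (s : Finset ι) (θ : ι → ℝ) (W M : ℕ)
    (hM : 0 < M) (hMW : M ≤ W)
    (hsep : ∀ p ∈ s, ∀ p' ∈ s, p ≠ p' → ∀ k : ℤ, 1 / (M : ℝ) ≤ |θ p - θ p' - k|) (g : ℤ → ℝ) :
    ∑ p ∈ s, ‖∑ k ∈ Finset.Icc (-W : ℤ) W, (g k : ℂ) * expCircle (k * θ p)‖ ^ 2 ≤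
      9 * W * ∑ k ∈ Finset.Icc (-W : ℤ) W, g k ^ 2 := by
  set G : ι → ℂ := fun p => ∑ k ∈ Finset.Icc (-W : ℤ) W, (g k : ℂ) * expCircle (k * θ p) with hG
  set F : ℤ → ℂ := fun k => ∑ p ∈ s, (starRingEnd ℂ) (G p) * expCircle (k * θ p) with hF
  set A : ℝ := ∑ p ∈ s, ‖G p‖ ^ 2 with hA
  -- Duality: A is the pairing of g with F, so Cauchy–Schwarz and the dual inequality for F give A²
  -- ≤ (∑ g²) · 9W · A.
  have h1 : (A : ℂ) = ∑ k ∈ Finset.Icc (-W : ℤ) W, (g k : ℂ) * F k := by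
    rw [hA]
    push_cast
    have : ∀ p ∈ s, ((‖G p‖ : ℂ)) ^ 2 = ∑ k ∈ Finset.Icc (-W : ℤ) W,
        (g k : ℂ) * ((starRingEnd ℂ) (G p) * expCircle (k * θ p)) := by
      intro p _
      rw [← Complex.conj_mul']
      nth_rewrite 2 [hG]
      rw [Finset.mul_sum]
      refine Finset.sum_congr rfl fun k _ => ?_
      ring
    rw [Finset.sum_congr rfl this, Finset.sum_comm]
    refine Finset.sum_congr rfl fun k _ => ?_
    rw [hF, Finset.mul_sum]
  have hA0 : 0 ≤ A := by positivity
  have h2 : A ≤ ∑ k ∈ Finset.Icc (-W : ℤ) W, |g k| * ‖F k‖ := by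
    rw [← abs_of_nonneg hA0, ← Real.norm_eq_abs, ← Complex.norm_real, h1]
    refine (norm_sum_le _ _).trans (Finset.sum_le_sum fun k _ => ?_)
    rw [norm_mul, Complex.norm_real, Real.norm_eq_abs]
  have h3 := Finset.sum_mul_sq_le_sq_mul_sq (Finset.Icc (-W : ℤ) W) (fun k => |g k|) fun k => ‖F k‖
  simp only [sq_abs] at h3
  have h4 := sum_norm_sq_trigPoly_le s θ W M hM hMW hsep fun p => (starRingEnd ℂ) (G p)
  simp only [Complex.norm_conj] at h4
  have h5 : A ^ 2 ≤ (∑ k ∈ Finset.Icc (-W : ℤ) W, g k ^ 2) * (9 * W * A) :=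
    (pow_le_pow_left₀ hA0 h2 2).trans (h3.trans (mul_le_mul_of_nonneg_left h4 (by positivity)))
  rcases hA0.eq_or_lt with h | h
  · rw [← h]; positivity
  · refine le_of_mul_le_mul_right (a := A) ?_ h
    nlinarith

/-- The reduced fractions `r / d` in `[0, 1)` with denominator `d`, as a set of numerators. -/
def reducedNumerators (d : ℕ) : Finset ℕ := {r ∈ Finset.range d | r.Coprime d}

/-- Over the common denominator d d' ≤ D² the difference has an integer numerator m, which is
nonzero because distinct reduced fractions in [0, 1) differ modulo 1. -/
lemma abs_reduced_sub_ge {d r d' r' D : ℕ} (hd : 0 < d) (hd' : 0 < d') (hdD : d ≤ D)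
    (hdD' : d' ≤ D) (hr : r ∈ reducedNumerators d) (hr' : r' ∈ reducedNumerators d')
    (hne : (⟨d, r⟩ : Σ _ : ℕ, ℕ) ≠ ⟨d', r'⟩) (k : ℤ) :
    1 / ((D ^ 2 : ℕ) : ℝ) ≤ |(r : ℝ) / d - (r' : ℝ) / d' - k| := by
  simp only [reducedNumerators, Finset.mem_filter, Finset.mem_range] at hr hr'
  have hdp : (0 : ℝ) < d := by exact_mod_cast hd
  have hdp' : (0 : ℝ) < d' := by exact_mod_cast hd'
  have hDp : (0 : ℝ) < D := by exact_mod_cast hd.trans_le hdD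
  set m : ℤ := r * d' - r' * d - k * (d * d') with hm
  have hm0 : m ≠ 0 := by
    intro h0
    have e1 : (r : ℤ) * d' = d * (r' + k * d') := by linarith
    have e2 : (r' : ℤ) * d = d' * (r - k * d) := by linarith
    have c1 : (d : ℤ) ∣ d' := by
      have h : IsCoprime (d : ℤ) r := Nat.isCoprime_iff_coprime.2 hr.2.symm
      exact h.dvd_of_dvd_mul_left ⟨_, e1⟩
    have c2 : (d' : ℤ) ∣ d := by
      have h : IsCoprime (d' : ℤ) r' := Nat.isCoprime_iff_coprime.2 hr'.2.symm
      exact h.dvd_of_dvd_mul_left ⟨_, e2⟩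
    have c3 : d = d' := Nat.dvd_antisymm (by exact_mod_cast c1) (by exact_mod_cast c2)
    subst c3
    have e3 : (r : ℤ) = r' + k * d := by
      have : (d : ℤ) ≠ 0 := by exact_mod_cast hd.ne'
      apply mul_left_cancel₀ this
      linarith
    have hk : k = 0 := by
      by_contra hk
      rcases lt_or_gt_of_ne hk with h | h
      · have : k ≤ -1 := by omega
        have : k * d ≤ -1 * d := by gcongr
        omega
      · have : 1 ≤ k := by omega
        have : 1 * d ≤ k * (d : ℤ) := by gcongr
        omega
    apply hne
    rw [hk] at e3
    simp only [zero_mul, add_zero] at e3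
    have : r = r' := by exact_mod_cast e3
    rw [this]
  have h1 : (1 : ℝ) ≤ |(m : ℝ)| := by
    have := Int.one_le_abs hm0
    exact_mod_cast this
  have h2 : (r : ℝ) / d - (r' : ℝ) / d' - k = m / (d * d') := by
    rw [hm]
    push_cast
    field_simp
  rw [h2, abs_div, abs_of_pos (mul_pos hdp hdp')]
  push_cast
  have h3 : (d : ℝ) * d' ≤ D ^ 2 := by
    rw [sq]
    gcongr
  gcongr

/-- The large sieve inequality for Farey fractions. -/
theorem large_sieve_farey (D W : ℕ) (hW : D ^ 2 ≤ W) (g : ℤ → ℝ) :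
    ∑ d ∈ Finset.Icc 1 D, ∑ r ∈ reducedNumerators d,
      ‖∑ k ∈ Finset.Icc (-W : ℤ) W, (g k : ℂ) * expCircle (k * ((r : ℝ) / d))‖ ^ 2 ≤
      9 * W * ∑ k ∈ Finset.Icc (-W : ℤ) W, g k ^ 2 := by
  rcases Nat.eq_zero_or_pos D with rfl | hD
  · simp
    positivity
  rw [Finset.sum_sigma']
  refine large_sieve_of_separated ((Finset.Icc 1 D).sigma reducedNumerators)
    (fun p => (p.2 : ℝ) / p.1) W (D ^ 2) (by positivity) hW ?_ g
  rintro ⟨d, r⟩ hp ⟨d', r'⟩ hp' hne k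
  simp only [Finset.mem_sigma, Finset.mem_Icc] at hp hp'
  exact abs_reduced_sub_ge (by omega) (by omega) hp.1.2 hp'.1.2 hp.2 hp'.2 hne k

/-! ### The walk as a sum of independent digits -/

/-- The defining properties of the densities `p m` of the variables `∑ i < m, a ^ i * b i`, where
the `b i` are independent with finitely supported density `w`. -/
structure IsDigitWalk (a L : ℕ) (S : Finset ℤ) (w : ℤ → ℝ) (p : ℕ → ℤ → ℝ) : Prop where
  one_lt : 1 < a
  one_le : 1 ≤ L
  pos : ∀ b ∈ S, 0 < w b
  sum_eq : ∑ b ∈ S, w b = 1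
  abs_le : ∀ b ∈ S, |b| ≤ L
  zero : ∀ x, p 0 x = if x = 0 then 1 else 0
  succ : ∀ m x, p (m + 1) x = ∑ b ∈ S, w b * p m (x - a ^ m * b)
  add : ∀ m k x, p (m + k) x = ∑' y, p k y * p m (x - a ^ m * y)
  one : ∀ x, p 1 x = if x ∈ S then w x else 0

lemma map_add_left_apply (P : PMF ℤ) (c x : ℤ) : (P.map fun z => c + z) x = P (x - c) := by
  rw [PMF.map_apply, tsum_eq_single (x - c)]
  · simp
  · intro z hz
    rw [if_neg]
    rintro rfl
    simp at hz

/-- After k steps have produced y, m further steps multiply y by a^m and add an independent copy of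
X_m. The case k = 1 adds a digit at the top place a^m, whereas the defining recursion inserts one at
the bottom. -/
lemma walkLaw_add (a : ℕ) (μ : PMF ℤ) (m k : ℕ) :
    walkLaw a μ (m + k) =
      (walkLaw a μ k).bind fun y => (walkLaw a μ m).map fun x => (a : ℤ) ^ m * y + x := by
  induction m with
  | zero => simp [walkLaw, PMF.pure_map, PMF.bind_pure]
  | succ m ih =>
    rw [show m + 1 + k = (m + k) + 1 by ring]
    simp only [walkLaw]
    rw [ih, PMF.bind_bind]
    congr 1
    funext y
    rw [PMF.bind_map, PMF.map_bind]
    congr 1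
    funext x
    rw [PMF.map_comp]
    simp only [Function.comp]
    congr 1
    funext b
    simp only [Function.comp]
    ring

lemma walkLaw_one (a : ℕ) (μ : PMF ℤ) : walkLaw a μ 1 = μ := by
  have h1 : walkLaw a μ 1 = PMF.map id μ := by
    simp only [walkLaw, PMF.pure_bind, mul_zero, zero_add]
    rfl
  rw [h1, PMF.map_id]

lemma walkLaw_add_apply_toReal (a : ℕ) (μ : PMF ℤ) (m k : ℕ) (x : ℤ) :
    (walkLaw a μ (m + k) x).toReal =
      ∑' y, (walkLaw a μ k y).toReal * (walkLaw a μ m (x - a ^ m * y)).toReal := by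
  rw [walkLaw_add, PMF.bind_apply, ENNReal.tsum_toReal_eq]
  · simp only [map_add_left_apply, ENNReal.toReal_mul]
  · intro y
    exact ENNReal.mul_ne_top (PMF.apply_ne_top _ _) (PMF.apply_ne_top _ _)

lemma exists_isDigitWalk (a : ℕ) (ha : 1 < a) (μ : PMF ℤ) (hfin : μ.support.Finite) :
    ∃ L, IsDigitWalk a L hfin.toFinset (fun b => (μ b).toReal)
      (fun m x => (walkLaw a μ m x).toReal) := by
  obtain ⟨L, hL⟩ := (hfin.toFinset.image Int.natAbs).bddAbove
  -- The extra 1 ensures `1 ≤ L` even when every digit is 0.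
  refine ⟨L + 1, ha, by omega, ?_, ?_, ?_, ?_, ?_, ?_, ?_⟩
  · intro b hb
    rw [Set.Finite.mem_toFinset, PMF.mem_support_iff] at hb
    exact ENNReal.toReal_pos hb (PMF.apply_ne_top _ _)
  · have h1 : ∑' b, μ b = ∑ b ∈ hfin.toFinset, μ b := by
      refine tsum_eq_sum fun b hb => ?_
      rw [Set.Finite.mem_toFinset, PMF.mem_support_iff, not_not] at hb
      exact hb
    rw [← ENNReal.toReal_sum fun b _ => PMF.apply_ne_top _ _, ← h1, PMF.tsum_coe,
      ENNReal.toReal_one]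
  · intro b hb
    have := hL (Finset.mem_coe.2 (Finset.mem_image_of_mem Int.natAbs hb))
    rw [Int.abs_eq_natAbs]
    exact_mod_cast this.trans (Nat.le_succ L)
  · intro x
    simp only [walkLaw, PMF.pure_apply]
    split_ifs <;> simp
  · intro m x
    rw [walkLaw_add_apply_toReal, walkLaw_one, tsum_eq_sum]
    intro b hb
    rw [Set.Finite.mem_toFinset, PMF.mem_support_iff, not_not] at hb
    simp [hb]
  · intro m k x
    exact walkLaw_add_apply_toReal a μ m k x
  · intro x
    simp only [walkLaw_one, Set.Finite.mem_toFinset, PMF.mem_support_iff]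
    split_ifs with h
    · rfl
    · rw [not_not] at h
      simp [h]

/-- The support of a finitely supported function, as a finset. -/
noncomputable def supportFinset {g : ℤ → ℝ} (hg : g.HasFiniteSupport) : Finset ℤ :=
  Set.Finite.toFinset (s := Function.support g) hg

lemma mem_supportFinset {g : ℤ → ℝ} {hg : g.HasFiniteSupport} {x : ℤ} :
    x ∈ supportFinset hg ↔ g x ≠ 0 := by
  exact (Set.Finite.mem_toFinset (s := Function.support g) hg).trans Function.mem_support

/-- The sum of a weighted family of translates of `g`. -/
noncomputable def translateAvg (S : Finset ℤ) (w : ℤ → ℝ) (c : ℤ) (g : ℤ → ℝ) (x : ℤ) : ℝ :=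
  ∑ b ∈ S, w b * g (x - c * b)

lemma hasFiniteSupport_translate {g : ℤ → ℝ} (hg : g.HasFiniteSupport) (c : ℤ) :
    (fun x => g (x - c)).HasFiniteSupport := by
  refine (Set.Finite.image (fun y => y + c) hg).subset ?_
  intro x hx
  exact ⟨x - c, hx, by simp⟩

lemma HasFiniteSupport.of_eq_zero {g g' : ℤ → ℝ} (hg : g.HasFiniteSupport)
    (h : ∀ x, g x = 0 → g' x = 0) : g'.HasFiniteSupport :=
  Set.Finite.subset hg fun x hx h0 => hx (h x h0)

lemma tsum_translate (g : ℤ → ℝ) (c : ℤ) : ∑' x, g (x - c) = ∑' x, g x :=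
  (Equiv.subRight c).tsum_eq g

lemma hasFiniteSupport_translateAvg {g : ℤ → ℝ} (hg : g.HasFiniteSupport) (S : Finset ℤ)
    (w : ℤ → ℝ) (c : ℤ) : (translateAvg S w c g).HasFiniteSupport := by
  refine Set.Finite.subset (S.finite_toSet.biUnion fun b _ =>
    hasFiniteSupport_translate hg (c * b)) ?_
  intro x hx
  obtain ⟨b, hb, h⟩ := Finset.exists_ne_zero_of_sum_ne_zero hx
  exact Set.mem_biUnion hb (right_ne_zero_of_mul h)

lemma summable_translate_mul {g : ℤ → ℝ} (hg : g.HasFiniteSupport) (c : ℤ) (r : ℝ) :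
    Summable fun x => r * g (x - c) :=
  (summable_of_hasFiniteSupport (hasFiniteSupport_translate hg c)).mul_left r

lemma tsum_translateAvg {g : ℤ → ℝ} (hg : g.HasFiniteSupport) (S : Finset ℤ)
    (w : ℤ → ℝ) (c : ℤ) : ∑' x, translateAvg S w c g x = (∑ b ∈ S, w b) * ∑' x, g x := by
  simp only [translateAvg]
  rw [Summable.tsum_finsetSum fun b _ => summable_translate_mul hg (c * b) (w b), Finset.sum_mul]
  refine Finset.sum_congr rfl fun b _ => ?_
  rw [tsum_mul_left, tsum_translate]

namespace IsDigitWalk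

variable {a L : ℕ} {S : Finset ℤ} {w : ℤ → ℝ} {p : ℕ → ℤ → ℝ}

lemma succ_eq (h : IsDigitWalk a L S w p) (m : ℕ) :
    p (m + 1) = translateAvg S w (a ^ m) (p m) := funext (h.succ m)

lemma nonneg (h : IsDigitWalk a L S w p) (m : ℕ) (x : ℤ) : 0 ≤ p m x := by
  induction m generalizing x with
  | zero => rw [h.zero]; split_ifs <;> norm_num
  | succ m ih =>
    rw [h.succ]
    exact Finset.sum_nonneg fun b hb => mul_nonneg (h.pos b hb).le (ih _)

lemma abs_le_of_ne_zero (h : IsDigitWalk a L S w p) {m : ℕ} {x : ℤ} (hx : p m x ≠ 0) :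
    |x| ≤ L * a ^ m := by
  induction m generalizing x with
  | zero =>
    rw [h.zero] at hx
    have : x = 0 := by
      by_contra h0
      simp [h0] at hx
    simp [this]
  | succ m ih =>
    rw [h.succ] at hx
    obtain ⟨b, hb, hne⟩ := Finset.exists_ne_zero_of_sum_ne_zero hx
    have h1 := ih (right_ne_zero_of_mul hne)
    have h2 := h.abs_le b hb
    have h3 : |x| ≤ |x - a ^ m * b| + |(a : ℤ) ^ m * b| := by
      have := abs_add_le (x - a ^ m * b) (a ^ m * b)
      simpa using this
    have h4 : |(a : ℤ) ^ m * b| ≤ a ^ m * L := by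
      rw [abs_mul, abs_of_nonneg (by positivity)]
      gcongr
    have h5 : (2 : ℤ) ≤ a := by exact_mod_cast h.one_lt
    have h6 : (L : ℤ) * a ^ m * 2 ≤ L * a ^ m * a := by gcongr
    rw [pow_succ]
    linarith

lemma hasFiniteSupport (h : IsDigitWalk a L S w p) (m : ℕ) : (p m).HasFiniteSupport := by
  refine (Set.finite_Icc (-((L : ℤ) * a ^ m)) (L * a ^ m)).subset ?_
  intro x hx
  exact _root_.abs_le.1 (h.abs_le_of_ne_zero hx)

lemma tsum_eq (h : IsDigitWalk a L S w p) (m : ℕ) : ∑' x, p m x = 1 := by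
  induction m with
  | zero =>
    simp only [h.zero]
    exact tsum_ite_eq 0 _
  | succ m ih => rw [h.succ_eq, tsum_translateAvg (h.hasFiniteSupport m), ih, h.sum_eq, one_mul]

lemma summable (h : IsDigitWalk a L S w p) (m : ℕ) : Summable (p m) :=
  summable_of_hasFiniteSupport (h.hasFiniteSupport m)

lemma le_one (h : IsDigitWalk a L S w p) (m : ℕ) (x : ℤ) : p m x ≤ 1 := by
  rw [← h.tsum_eq m]
  exact (h.summable m).le_tsum x fun y _ => h.nonneg m y

end IsDigitWalk

/-! ### Power sums and their submultiplicativity -/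

/-- The power sum `∑ x, g x ^ t`. -/
noncomputable def powerSum (g : ℤ → ℝ) (t : ℝ) : ℝ := ∑' x, g x ^ t

lemma hasFiniteSupport_rpow {g : ℤ → ℝ} (hg : g.HasFiniteSupport) {t : ℝ} (ht : 0 < t) :
    (fun x => g x ^ t).HasFiniteSupport :=
  HasFiniteSupport.of_eq_zero hg fun x hx => by simp [hx, Real.zero_rpow ht.ne']

lemma rpow_sum_le_sum_rpow {ι : Type*} (s : Finset ι) {f : ι → ℝ} (hf : ∀ i ∈ s, 0 ≤ f i) {t : ℝ}
    (h0 : 0 < t) (h1 : t ≤ 1) : (∑ i ∈ s, f i) ^ t ≤ ∑ i ∈ s, f i ^ t := by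
  classical
  induction s using Finset.induction_on with
  | empty => simp [Real.zero_rpow h0.ne']
  | insert i s hi ih =>
    rw [Finset.sum_insert hi, Finset.sum_insert hi]
    have h2 := Real.rpow_add_le_add_rpow (hf i (Finset.mem_insert_self i s))
      (Finset.sum_nonneg fun j hj => hf j (Finset.mem_insert_of_mem hj)) h0.le h1
    have := ih fun j hj => hf j (Finset.mem_insert_of_mem hj)
    linarith

namespace IsDigitWalk

variable {a L : ℕ} {S : Finset ℤ} {w : ℤ → ℝ} {p : ℕ → ℤ → ℝ}

lemma add_eq_sum (h : IsDigitWalk a L S w p) (m k : ℕ) (x : ℤ) :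
    p (m + k) x =
      ∑ y ∈ supportFinset (h.hasFiniteSupport k), p k y * p m (x - a ^ m * y) := by
  rw [h.add, tsum_eq_sum]
  intro y hy
  rw [mem_supportFinset, not_not] at hy
  rw [hy, zero_mul]

/-- The right side of the pointwise bound is a weighted sum of translates of p_m^t, so summing over
x factorises it. -/
lemma powerSum_add_le_of_pointwise (h : IsDigitWalk a L S w p) {t : ℝ} (ht : 0 < t) (m k : ℕ)
    {A : ℝ} (hA : ∀ x, p (m + k) x ^ t ≤
      A * ∑ y ∈ supportFinset (h.hasFiniteSupport k), (p k y * p m (x - a ^ m * y)) ^ t) :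
    powerSum (p (m + k)) t ≤ A * (powerSum (p m) t * powerSum (p k) t) := by
  set Y := supportFinset (h.hasFiniteSupport k) with hY
  have h1 : powerSum (p k) t = ∑ y ∈ Y, p k y ^ t := by
    refine tsum_eq_sum fun y hy => ?_
    rw [hY, mem_supportFinset, not_not] at hy
    rw [hy, Real.zero_rpow ht.ne']
  have h2 : ∀ x, ∑ y ∈ Y, (p k y * p m (x - a ^ m * y)) ^ t =
      translateAvg Y (fun y => p k y ^ t) (a ^ m) (fun x => p m x ^ t) x := fun x =>
    Finset.sum_congr rfl fun y _ => Real.mul_rpow (h.nonneg _ _) (h.nonneg _ _)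
  have hfs := hasFiniteSupport_rpow (h.hasFiniteSupport m) ht
  calc powerSum (p (m + k)) t
      ≤ ∑' x, A * translateAvg Y (fun y => p k y ^ t) (a ^ m) (fun x => p m x ^ t) x := by
        refine Summable.tsum_le_tsum (fun x => (hA x).trans_eq (by rw [h2])) ?_ ?_
        · exact summable_of_hasFiniteSupport (hasFiniteSupport_rpow (h.hasFiniteSupport _) ht)
        · exact (summable_of_hasFiniteSupport
            (hasFiniteSupport_translateAvg hfs _ _ _)).mul_left _
    _ = A * (powerSum (p m) t * powerSum (p k) t) := by
        rw [tsum_mul_left, tsum_translateAvg hfs, h1, mul_comm (∑ y ∈ Y, _)]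
        rfl

lemma powerSum_add_le (h : IsDigitWalk a L S w p) {t : ℝ} (h0 : 0 < t) (h1 : t ≤ 1) (m k : ℕ) :
    powerSum (p (m + k)) t ≤ powerSum (p m) t * powerSum (p k) t := by
  refine (h.powerSum_add_le_of_pointwise h0 m k (A := 1) fun x => ?_).trans_eq (one_mul _)
  rw [one_mul, h.add_eq_sum]
  exact rpow_sum_le_sum_rpow _ (fun y _ => mul_nonneg (h.nonneg _ _) (h.nonneg _ _)) h0 h1

/-- Overlaps are bounded: p_m(x - a^m y) ≠ 0 forces |x - a^m y| ≤ L a^m, which leaves at most 2L+1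
values of y around x / a^m. The power mean inequality then costs (2L+1)^(t-1). -/
lemma powerSum_add_le' (h : IsDigitWalk a L S w p) {t : ℝ} (h1 : 1 ≤ t) (m k : ℕ) :
    powerSum (p (m + k)) t ≤
      ((2 * L + 1 : ℕ) : ℝ) ^ (t - 1) * (powerSum (p m) t * powerSum (p k) t) := by
  refine h.powerSum_add_le_of_pointwise (by linarith) m k fun x => ?_
  set Y := supportFinset (h.hasFiniteSupport k) with hY
  set Y' := Y.filter fun y => p m (x - a ^ m * y) ≠ 0 with hY'
  have hapos : (0 : ℤ) < a ^ m := by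
    have := h.one_lt
    positivity
  have hcard : Y'.card ≤ 2 * L + 1 := by
    rcases Y'.eq_empty_or_nonempty with he | ⟨y0, hy0⟩
    · simp [he]
    · have hsub : Y' ⊆ Finset.Icc (x / a ^ m - L) (x / a ^ m + L) := by
        intro y hy
        have hy1 := h.abs_le_of_ne_zero (Finset.mem_filter.1 hy).2
        rw [_root_.abs_le] at hy1
        rw [Finset.mem_Icc]
        have e1 := Int.emod_add_mul_ediv x (a ^ m)
        have e2 := Int.emod_nonneg x hapos.ne'
        have e3 := Int.emod_lt_of_pos x hapos
        set q := x / (a : ℤ) ^ m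
        set r := x % (a : ℤ) ^ m
        set A := (a : ℤ) ^ m
        constructor
        · by_contra hlt
          push Not at hlt
          have : y + 1 ≤ q - L := by omega
          have : A * (y + 1) ≤ A * (q - L) := by gcongr
          nlinarith [hy1.2]
        · by_contra hlt
          push Not at hlt
          have : q + L + 1 ≤ y := by omega
          have : A * (q + L + 1) ≤ A * y := by gcongr
          nlinarith [hy1.1]
      refine (Finset.card_le_card hsub).trans ?_
      rw [Int.card_Icc]
      omega
  have hsum : p (m + k) x = ∑ y ∈ Y', p k y * p m (x - a ^ m * y) := by
    rw [h.add_eq_sum, hY', Finset.sum_filter]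
    refine Finset.sum_congr rfl fun y _ => ?_
    by_cases h0 : p m (x - a ^ m * y) = 0 <;> simp [h0]
  have hnn : ∀ y, 0 ≤ p k y * p m (x - a ^ m * y) := fun y =>
    mul_nonneg (h.nonneg _ _) (h.nonneg _ _)
  rw [hsum]
  refine (Real.rpow_sum_le_const_mul_sum_rpow_of_nonneg Y' h1 fun y _ => hnn y).trans ?_
  have h2 : ∑ y ∈ Y', (p k y * p m (x - a ^ m * y)) ^ t ≤
      ∑ y ∈ Y, (p k y * p m (x - a ^ m * y)) ^ t :=
    Finset.sum_le_sum_of_subset_of_nonneg (Finset.filter_subset _ _) fun y _ _ =>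
      Real.rpow_nonneg (hnn y) t
  have h3 : ((Y'.card : ℕ) : ℝ) ^ (t - 1) ≤ ((2 * L + 1 : ℕ) : ℝ) ^ (t - 1) :=
    Real.rpow_le_rpow (by positivity) (by exact_mod_cast hcard) (by linarith)
  exact mul_le_mul h3 h2 (Finset.sum_nonneg fun y _ => Real.rpow_nonneg (hnn y) t) (by positivity)

lemma powerSum_one (h : IsDigitWalk a L S w p) (m : ℕ) : powerSum (p m) 1 = 1 := by
  simp only [powerSum, Real.rpow_one]
  exact h.tsum_eq m

lemma powerSum_nonneg (h : IsDigitWalk a L S w p) (m : ℕ) (t : ℝ) : 0 ≤ powerSum (p m) t :=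
  tsum_nonneg fun x => Real.rpow_nonneg (h.nonneg m x) t

end IsDigitWalk

/-! ### The entropy rate and exponential tail bounds -/

lemma hasDerivAt_powerSum {g : ℤ → ℝ} (hg : g.HasFiniteSupport) (hg0 : ∀ x, 0 ≤ g x) :
    HasDerivAt (powerSum g) (-∑' x, Real.negMulLog (g x)) 1 := by
  have e1 : ∑' x, Real.negMulLog (g x) = ∑ x ∈ supportFinset hg, Real.negMulLog (g x) := by
    refine tsum_eq_sum fun x hx => ?_
    rw [mem_supportFinset, not_not] at hx
    simp [hx]
  have e2 : HasDerivAt (fun t : ℝ => ∑ x ∈ supportFinset hg, g x ^ t)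
      (∑ x ∈ supportFinset hg, -Real.negMulLog (g x)) 1 := by
    refine HasDerivAt.fun_sum fun x hx => ?_
    rw [mem_supportFinset] at hx
    have := (Real.hasStrictDerivAt_const_rpow ((hg0 x).lt_of_ne' hx) 1).hasDerivAt
    convert this using 1
    rw [Real.negMulLog, Real.rpow_one]
    ring
  rw [e1, ← Finset.sum_neg_distrib]
  refine e2.congr_of_eventuallyEq ?_
  filter_upwards [lt_mem_nhds (zero_lt_one : (0 : ℝ) < 1)] with t ht
  refine tsum_eq_sum fun x hx => ?_
  rw [mem_supportFinset, not_not] at hx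
  rw [hx, Real.zero_rpow ht.ne']

lemma nonneg_of_hasDerivAt_of_le {F : ℝ → ℝ} {F' : ℝ} (hF : HasDerivAt F F' 0)
    (h : ∀ s, 0 < s → s < 1 → F 0 ≤ F s) : 0 ≤ F' := by
  have h1 : Tendsto (slope F 0) (𝓝[>] 0) (𝓝 F') :=
    (hasDerivAt_iff_tendsto_slope.1 hF).mono_left
      (nhdsWithin_mono 0 fun x hx => (ne_of_gt hx : x ≠ 0))
  refine ge_of_tendsto h1 ?_
  filter_upwards [Ioo_mem_nhdsGT (zero_lt_one : (0 : ℝ) < 1)] with s hs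
  rw [slope_def_field, sub_zero]
  exact div_nonneg (sub_nonneg.2 (h s hs.1 hs.2)) hs.1.le

/-- Supplies the parameter s of the Chernoff bounds. -/
lemma exists_lt_of_hasDerivAt_neg {F : ℝ → ℝ} {F' : ℝ} (hF : HasDerivAt F F' 0) (hF' : F' < 0) :
    ∃ s, 0 < s ∧ s < 1 ∧ F s < F 0 := by
  by_contra hcon
  push Not at hcon
  exact absurd (nonneg_of_hasDerivAt_of_le hF hcon) (not_le.2 hF')

/-- A submultiplicative sequence with a term smaller than `1` decays exponentially. -/
lemma exists_geometric_bound {v : ℕ → ℝ} (hv : ∀ n, 0 ≤ v n) (hmul : ∀ m n, v (m + n) ≤ v m * v n)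
    {k : ℕ} (hk : 0 < k) (hvk : v k < 1) :
    ∃ A ρ : ℝ, 0 ≤ A ∧ 0 < ρ ∧ ρ < 1 ∧ ∀ n, v n ≤ A * ρ ^ n := by
  -- A midpoint rather than v k itself, so that ρ, its k-th root, is positive even when v k = 0.
  set r : ℝ := (v k + 1) / 2 with hr
  have hr0 : 0 < r := by have := hv k; positivity
  have hr1 : r < 1 := by linarith
  have hvr : v k ≤ r := by linarith
  set ρ : ℝ := r ^ (1 / (k : ℝ)) with hρ
  have hk' : (0 : ℝ) < k := by exact_mod_cast hk
  have hρ0 : 0 < ρ := Real.rpow_pos_of_pos hr0 _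
  have hρ1 : ρ < 1 := Real.rpow_lt_one hr0.le hr1 (by positivity)
  have hρk : ρ ^ k = r := by
    rw [hρ, ← Real.rpow_natCast, ← Real.rpow_mul hr0.le, one_div_mul_cancel hk'.ne', Real.rpow_one]
  set A : ℝ := ∑ i ∈ Finset.range k, v i / ρ ^ i with hA
  have hA0 : 0 ≤ A := Finset.sum_nonneg fun i _ => div_nonneg (hv i) (by positivity)
  refine ⟨A, ρ, hA0, hρ0, hρ1, fun n => ?_⟩
  induction n using Nat.strong_induction_on with
  | _ n ih =>
    rcases lt_or_ge n k with h | h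
    · have h1 : v n / ρ ^ n ≤ A :=
        Finset.single_le_sum (f := fun i => v i / ρ ^ i)
          (fun i _ => div_nonneg (hv i) (by positivity)) (Finset.mem_range.2 h)
      rwa [div_le_iff₀ (by positivity)] at h1
    · obtain ⟨j, rfl⟩ := Nat.exists_eq_add_of_le h
      calc v (k + j) ≤ v k * v j := hmul k j
        _ ≤ r * (A * ρ ^ j) := mul_le_mul hvr (ih j (by omega)) (hv j) hr0.le
        _ = A * ρ ^ (k + j) := by rw [pow_add, hρk]; ring

/-- The Shannon entropy of a density on `ℤ`. -/
noncomputable def shannonEntropy (g : ℤ → ℝ) : ℝ := ∑' x, Real.negMulLog (g x)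

/-- The mass of the points satisfying a predicate. -/
noncomputable def massOn (g : ℤ → ℝ) (P : ℤ → Prop) : ℝ := by
  classical exact ∑' x, if P x then g x else 0

/-- The entropy of a digit walk grows at linear rate `H`. -/
structure HasEntropyRate (p : ℕ → ℤ → ℝ) (H : ℝ) : Prop where
  tendsto : Tendsto (fun n : ℕ => shannonEntropy (p n) / n) atTop (𝓝 H)
  mul_le : ∀ n : ℕ, H * n ≤ shannonEntropy (p n)

namespace IsDigitWalk

variable {a L : ℕ} {S : Finset ℤ} {w : ℤ → ℝ} {p : ℕ → ℤ → ℝ}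

lemma shannonEntropy_nonneg (h : IsDigitWalk a L S w p) (m : ℕ) : 0 ≤ shannonEntropy (p m) :=
  tsum_nonneg fun x => Real.negMulLog_nonneg (h.nonneg m x) (h.le_one m x)

lemma hasDerivAt_powerSum_sub (h : IsDigitWalk a L S w p) (m : ℕ) :
    HasDerivAt (fun s => powerSum (p m) (1 - s)) (shannonEntropy (p m)) 0 := by
  have h1 := hasDerivAt_powerSum (h.hasFiniteSupport m) (h.nonneg m)
  have h2 : HasDerivAt (fun s : ℝ => 1 - s) (-1) 0 := by
    simpa using (hasDerivAt_id (0 : ℝ)).const_sub 1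
  have h3 : HasDerivAt (powerSum (p m)) (-∑' x, Real.negMulLog (p m x)) (1 - 0) := by
    simpa using h1
  have h4 := h3.comp 0 h2
  rw [neg_mul_neg, mul_one] at h4
  exact h4

lemma hasDerivAt_powerSum_add (h : IsDigitWalk a L S w p) (m : ℕ) :
    HasDerivAt (fun s => powerSum (p m) (1 + s)) (-shannonEntropy (p m)) 0 := by
  have h1 := hasDerivAt_powerSum (h.hasFiniteSupport m) (h.nonneg m)
  have h2 : HasDerivAt (fun s : ℝ => 1 + s) 1 0 := by
    simpa using (hasDerivAt_id (0 : ℝ)).const_add 1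
  have h3 : HasDerivAt (powerSum (p m)) (-∑' x, Real.negMulLog (p m x)) (1 + 0) := by
    simpa using h1
  have h4 := h3.comp 0 h2
  rw [mul_one] at h4
  exact h4

/-- Submultiplicativity of the power sums with exponent 1 - s is an equality at s = 0; comparing
right derivatives there gives subadditivity. -/
lemma subadditive_shannonEntropy (h : IsDigitWalk a L S w p) :
    Subadditive fun m => shannonEntropy (p m) := by
  intro m k
  have h1 := ((h.hasDerivAt_powerSum_sub m).mul (h.hasDerivAt_powerSum_sub k)).sub
    (h.hasDerivAt_powerSum_sub (m + k))
  have h2 := nonneg_of_hasDerivAt_of_le h1 (by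
    intro s hs0 hs1
    have h3 := h.powerSum_add_le (t := 1 - s) (by linarith) (by linarith) m k
    simp only [Pi.sub_apply, Pi.mul_apply, sub_zero, h.powerSum_one]
    linarith)
  simp only [sub_zero, h.powerSum_one] at h2
  linarith

/-- By Fekete's lemma the limit is also the infimum, which gives the lower bound at every finite
time. -/
theorem exists_hasEntropyRate (h : IsDigitWalk a L S w p) : ∃ H, HasEntropyRate p H := by
  have hb : BddBelow (Set.range fun n : ℕ => shannonEntropy (p n) / n) := by
    refine ⟨0, ?_⟩
    rintro _ ⟨n, rfl⟩
    exact div_nonneg (h.shannonEntropy_nonneg n) (Nat.cast_nonneg n)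
  refine ⟨h.subadditive_shannonEntropy.lim, h.subadditive_shannonEntropy.tendsto_lim hb, ?_⟩
  intro n
  rcases Nat.eq_zero_or_pos n with rfl | hn
  · simpa using h.shannonEntropy_nonneg 0
  · have h1 := h.subadditive_shannonEntropy.lim_le_div hb hn.ne'
    rwa [le_div_iff₀ (by exact_mod_cast hn)] at h1

lemma massOn_le_of_pointwise (h : IsDigitWalk a L S w p) {m : ℕ} {P : ℤ → Prop} {A t : ℝ}
    (ht : 0 < t) (hA : 0 ≤ A) (hP : ∀ x, P x → p m x ≠ 0 → p m x ≤ A * p m x ^ t) :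
    massOn (p m) P ≤ A * powerSum (p m) t := by
  classical
  rw [massOn, powerSum, ← tsum_mul_left]
  refine Summable.tsum_le_tsum (fun x => ?_) ?_ ?_
  · have h0 : 0 ≤ A * p m x ^ t := mul_nonneg hA (Real.rpow_nonneg (h.nonneg m x) t)
    split_ifs with hx
    · by_cases hz : p m x = 0
      · rw [hz] at h0 ⊢
        exact h0
      · exact hP x hx hz
    · exact h0
  · exact summable_of_hasFiniteSupport
      (HasFiniteSupport.of_eq_zero (h.hasFiniteSupport m) fun x hx => by simp [hx])
  · exact (summable_of_hasFiniteSupport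
      (hasFiniteSupport_rpow (h.hasFiniteSupport m) ht)).mul_left A

/-- Chernoff's method: where p_n < exp(-(H+ε)n), write p_n = p_n^s p_n^(1-s) ≤ exp(-s(H+ε)n)
p_n^(1-s) and sum. The resulting bound is submultiplicative in n. At a time k with entropy below
(H+ε)k its s-derivative at 0 is negative, so some s makes it less than 1 at k, which forces
geometric decay. -/
theorem exists_massOn_small_le (h : IsDigitWalk a L S w p) {H : ℝ} (hH : HasEntropyRate p H)
    {ε : ℝ} (hε : 0 < ε) : ∃ A ρ : ℝ, 0 ≤ A ∧ 0 < ρ ∧ ρ < 1 ∧ ∀ n : ℕ,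
      massOn (p n) (fun x => p n x < Real.exp (-((H + ε) * n))) ≤ A * ρ ^ n := by
  obtain ⟨k, hk, hk0⟩ : ∃ k : ℕ, shannonEntropy (p k) / k < H + ε ∧ 0 < k :=
    ((hH.tendsto.eventually_lt_const (by linarith : H < H + ε)).and (eventually_gt_atTop 0)).exists
  have hk' : (0 : ℝ) < k := by exact_mod_cast hk0
  rw [div_lt_iff₀ hk'] at hk
  have hexp : HasDerivAt (fun s : ℝ => Real.exp (s * (-((H + ε) * k)))) (-((H + ε) * k)) 0 := by
    have := ((hasDerivAt_id (0 : ℝ)).mul_const (-((H + ε) * k))).exp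
    simpa using this
  obtain ⟨s, hs0, hs1, hs⟩ := exists_lt_of_hasDerivAt_neg
    (hexp.mul (h.hasDerivAt_powerSum_sub k)) (by
      simp only [sub_zero, h.powerSum_one, zero_mul, Real.exp_zero]
      linarith)
  simp only [Pi.mul_apply, sub_zero, h.powerSum_one, zero_mul, Real.exp_zero, mul_one] at hs
  obtain ⟨A, ρ, hA, hρ0, hρ1, hv⟩ := exists_geometric_bound
    (v := fun n => Real.exp (s * (-((H + ε) * n))) * powerSum (p n) (1 - s))
    (fun n => mul_nonneg (Real.exp_pos _).le (h.powerSum_nonneg n _))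
    (fun m n => by
      have h1 := h.powerSum_add_le (t := 1 - s) (by linarith) (by linarith) m n
      have h2 : Real.exp (s * (-((H + ε) * (m + n : ℕ)))) =
          Real.exp (s * (-((H + ε) * m))) * Real.exp (s * (-((H + ε) * n))) := by
        rw [← Real.exp_add]; congr 1; push_cast; ring
      rw [h2, mul_mul_mul_comm]
      exact mul_le_mul_of_nonneg_left h1 (by positivity)) hk0 hs
  refine ⟨A, ρ, hA, hρ0, hρ1, fun n => le_trans ?_ (hv n)⟩
  refine h.massOn_le_of_pointwise (by linarith) (Real.exp_pos _).le fun x hx hx0 => ?_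
  have hpos : 0 < p n x := (h.nonneg n x).lt_of_ne' hx0
  have h1 : p n x = p n x ^ s * p n x ^ (1 - s) := by
    rw [← Real.rpow_add hpos]; simp
  have h2 : p n x ^ s ≤ Real.exp (s * (-((H + ε) * n))) := by
    rw [mul_comm s, Real.exp_mul]
    exact Real.rpow_le_rpow hpos.le hx.le hs0.le
  calc p n x = p n x ^ s * p n x ^ (1 - s) := h1
    _ ≤ _ := mul_le_mul_of_nonneg_right h2 (Real.rpow_nonneg hpos.le _)

/-- The mirror argument with exponent 1 + s. The overlap factor (2L+1)^s is absorbed by adding c =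
log(2L+1) to the exponent, which restores submultiplicativity. -/
theorem exists_massOn_large_le (h : IsDigitWalk a L S w p) {H : ℝ} (hH : HasEntropyRate p H)
    {ε : ℝ} (hε : 0 < ε) : ∃ A ρ : ℝ, 0 ≤ A ∧ 0 < ρ ∧ ρ < 1 ∧ ∀ n : ℕ,
      massOn (p n) (fun x => Real.exp (-((H - ε) * n)) < p n x) ≤ A * ρ ^ n := by
  set c : ℝ := Real.log ((2 * L + 1 : ℕ) : ℝ) with hc
  have hc0 : 0 ≤ c := Real.log_natCast_nonneg _
  -- The entropy at time k is at least Hk, so εk > c makes the derivative (H-ε)k + c minus that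
  -- entropy negative.
  obtain ⟨k, hk⟩ := exists_nat_gt (c / ε)
  rw [div_lt_iff₀ hε] at hk
  have hk' : (0 : ℝ) < k := by
    by_contra h0
    push Not at h0
    nlinarith
  have hk0 : 0 < k := by exact_mod_cast hk'
  have hexp : HasDerivAt (fun s : ℝ => Real.exp (s * ((H - ε) * k + c))) ((H - ε) * k + c) 0 := by
    have := ((hasDerivAt_id (0 : ℝ)).mul_const ((H - ε) * k + c)).exp
    simpa using this
  obtain ⟨s, hs0, hs1, hs⟩ := exists_lt_of_hasDerivAt_neg
    (hexp.mul (h.hasDerivAt_powerSum_add k)) (by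
      simp only [add_zero, h.powerSum_one, zero_mul, Real.exp_zero]
      have := hH.mul_le k
      linarith)
  simp only [Pi.mul_apply, add_zero, h.powerSum_one, zero_mul, Real.exp_zero, mul_one] at hs
  obtain ⟨A, ρ, hA, hρ0, hρ1, hv⟩ := exists_geometric_bound
    (v := fun n => Real.exp (s * ((H - ε) * n + c)) * powerSum (p n) (1 + s))
    (fun n => mul_nonneg (Real.exp_pos _).le (h.powerSum_nonneg n _))
    (fun m n => by
      have h1 := h.powerSum_add_le' (t := 1 + s) (by linarith) m n
      have h2 : Real.exp (s * ((H - ε) * (m + n : ℕ) + c)) * ((2 * L + 1 : ℕ) : ℝ) ^ (1 + s - 1) =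
          Real.exp (s * ((H - ε) * m + c)) * Real.exp (s * ((H - ε) * n + c)) := by
        rw [Real.rpow_def_of_pos (by positivity), ← hc, ← Real.exp_add, ← Real.exp_add]
        congr 1; push_cast; ring
      rw [mul_mul_mul_comm, ← h2, mul_assoc]
      exact mul_le_mul_of_nonneg_left h1 (by positivity)) hk0 hs
  refine ⟨A, ρ, hA, hρ0, hρ1, fun n => le_trans ?_ (hv n)⟩
  refine h.massOn_le_of_pointwise (by linarith) (Real.exp_pos _).le fun x hx hx0 => ?_
  have hpos : 0 < p n x := (h.nonneg n x).lt_of_ne' hx0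
  have h1 : p n x ^ (1 + s) = p n x * p n x ^ s := by
    rw [Real.rpow_add hpos, Real.rpow_one]
  have h2 : Real.exp (s * (-((H - ε) * n))) ≤ p n x ^ s := by
    rw [mul_comm s, Real.exp_mul]
    exact Real.rpow_le_rpow (Real.exp_pos _).le hx.le hs0.le
  rw [h1]
  have h3 : 1 ≤ Real.exp (s * ((H - ε) * n + c)) * p n x ^ s := by
    calc (1 : ℝ) = Real.exp (s * ((H - ε) * n)) * Real.exp (s * (-((H - ε) * n))) := by
          rw [← Real.exp_add]; simp
      _ ≤ _ := by gcongr; linarith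
  calc p n x = p n x * 1 := (mul_one _).symm
    _ ≤ p n x * (Real.exp (s * ((H - ε) * n + c)) * p n x ^ s) := by gcongr
    _ = _ := by ring

/-! ### Positivity of the entropy rate -/

lemma exists_ne_zero (h : IsDigitWalk a L S w p) (m : ℕ) : ∃ x, p m x ≠ 0 := by
  by_contra hcon
  push Not at hcon
  have := h.tsum_eq m
  simp [hcon] at this

lemma sum_add_le_one (h : IsDigitWalk a L S w p) (m : ℕ) (I : Finset ℤ) {z : ℤ} (hz : z ∉ I) :
    ∑ x ∈ I, p m x + p m z ≤ 1 := by
  classical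
  rw [add_comm, ← Finset.sum_insert hz, ← h.tsum_eq m]
  exact (h.summable m).sum_le_tsum _ fun x _ => h.nonneg m x

/-- Process the digits in blocks of length k. The lowest block must lie in the residue class of x
modulo a^k. Its law charges ay + b₁ and ay + b₂, which are in different classes since 0 < |b₁ - b₂|
≤ 2L < a^k, so every class has mass at most κ < 1 and each block contributes a factor κ. -/
lemma exists_pow_bound (h : IsDigitWalk a L S w p) {b₁ b₂ : ℤ} (h₁ : b₁ ∈ S) (h₂ : b₂ ∈ S)
    (hne : b₁ ≠ b₂) : ∃ (k : ℕ) (κ : ℝ), 0 < k ∧ 0 < κ ∧ κ < 1 ∧ ∀ j x, p (k * j) x ≤ κ ^ j := by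
  classical
  obtain ⟨y, hy⟩ := h.exists_ne_zero (2 * L)
  -- This length guarantees a^k > 2L.
  set k := 1 + 2 * L with hk
  have hy0 : 0 < p (2 * L) y := (h.nonneg _ y).lt_of_ne' hy
  have hzpos : ∀ b ∈ S, 0 < p k (a * y + b) := by
    intro b hb
    rw [hk, h.add_eq_sum]
    refine lt_of_lt_of_le ?_ (Finset.single_le_sum
      (f := fun y' => p (2 * L) y' * p 1 (a * y + b - a ^ 1 * y'))
      (fun i _ => mul_nonneg (h.nonneg _ _) (h.nonneg _ _)) (mem_supportFinset.2 hy))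
    have : (a : ℤ) * y + b - a ^ 1 * y = b := by ring
    simp only [this, h.one, if_pos hb]
    exact mul_pos hy0 (h.pos b hb)
  -- The maximum with 1/2 only keeps κ positive, so that log κ is meaningful.
  set κ : ℝ := max (1 / 2) (1 - min (p k (a * y + b₁)) (p k (a * y + b₂))) with hκ
  have hmin : 0 < min (p k (a * y + b₁)) (p k (a * y + b₂)) := lt_min (hzpos _ h₁) (hzpos _ h₂)
  have hκ0 : 0 < κ := lt_of_lt_of_le (by norm_num) (le_max_left _ _)
  refine ⟨k, κ, by omega, hκ0, max_lt (by norm_num) (by linarith), ?_⟩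
  have hapos : (a : ℤ) ^ k ≠ 0 := by
    have := h.one_lt
    positivity
  have hres : ∀ (x : ℤ) (Y : Finset ℤ), ∑ y' ∈ Y, p k (x - a ^ k * y') ≤ κ := by
    intro x Y
    have hinj : Set.InjOn (fun y' : ℤ => x - (a : ℤ) ^ k * y') Y := by
      intro y₁ _ y₂ _ h12
      have : (a : ℤ) ^ k * y₁ = a ^ k * y₂ := by simpa using h12
      exact mul_left_cancel₀ hapos this
    rw [← Finset.sum_image (f := p k) hinj]
    set I := Y.image fun y' : ℤ => x - (a : ℤ) ^ k * y' with hI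
    have hone : (a * y + b₁ : ℤ) ∉ I ∨ (a * y + b₂ : ℤ) ∉ I := by
      by_contra hcon
      push Not at hcon
      obtain ⟨y₁, _, e1⟩ := Finset.mem_image.1 hcon.1
      obtain ⟨y₂, _, e2⟩ := Finset.mem_image.1 hcon.2
      have hdvd : (a : ℤ) ^ k ∣ b₁ - b₂ := ⟨y₂ - y₁, by linarith⟩
      have hle := Int.le_of_dvd (abs_pos.2 (sub_ne_zero.2 hne)) ((dvd_abs _ _).2 hdvd)
      have hb : |b₁ - b₂| ≤ 2 * L := by
        have e1 := _root_.abs_le.1 (h.abs_le b₁ h₁)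
        have e2 := _root_.abs_le.1 (h.abs_le b₂ h₂)
        rw [_root_.abs_le]
        constructor <;> linarith
      have hlt : k < a ^ k := Nat.lt_pow_self h.one_lt
      have hlt' : (k : ℤ) < (a : ℤ) ^ k := by exact_mod_cast hlt
      rw [hk] at hlt'
      push_cast at hlt'
      rw [hk] at hle
      linarith
    have hb : ∑ x ∈ I, p k x ≤ 1 - min (p k (a * y + b₁)) (p k (a * y + b₂)) := by
      rcases hone with hz | hz
      · have := h.sum_add_le_one k I hz
        have := min_le_left (p k (a * y + b₁)) (p k (a * y + b₂))
        linarith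
      · have := h.sum_add_le_one k I hz
        have := min_le_right (p k (a * y + b₁)) (p k (a * y + b₂))
        linarith
    exact hb.trans (le_max_right _ _)
  intro j
  induction j with
  | zero =>
    intro x
    simpa using h.le_one 0 x
  | succ j ih =>
    intro x
    rw [show k * (j + 1) = k + k * j by ring, h.add_eq_sum, pow_succ]
    calc _ ≤ ∑ y' ∈ supportFinset (h.hasFiniteSupport (k * j)), κ ^ j * p k (x - a ^ k * y') :=
          Finset.sum_le_sum fun y' _ => mul_le_mul_of_nonneg_right (ih y') (h.nonneg _ _)
      _ = κ ^ j * ∑ y' ∈ supportFinset (h.hasFiniteSupport (k * j)), p k (x - a ^ k * y') := by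
          rw [Finset.mul_sum]
      _ ≤ κ ^ j * κ := by gcongr; exact hres _ _

/-- Entropy is at least minus the logarithm of any upper bound for the point masses; along multiples
of k this gives H ≥ -log κ / k. -/
theorem entropyRate_pos (h : IsDigitWalk a L S w p) {H : ℝ} (hH : HasEntropyRate p H)
    {b₁ b₂ : ℤ} (h₁ : b₁ ∈ S) (h₂ : b₂ ∈ S) (hne : b₁ ≠ b₂) : 0 < H := by
  obtain ⟨k, κ, hk, hκ0, hκ1, hb⟩ := h.exists_pow_bound h₁ h₂ hne
  have hk' : (0 : ℝ) < k := by exact_mod_cast hk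
  have hlog : 0 < -Real.log κ := by
    have := Real.log_neg hκ0 hκ1
    linarith
  refine lt_of_lt_of_le (div_pos hlog hk') ?_
  have htend : Tendsto (fun j : ℕ => k * j) atTop atTop :=
    tendsto_id.const_mul_atTop' hk
  refine ge_of_tendsto (hH.tendsto.comp htend) ?_
  filter_upwards [eventually_gt_atTop 0] with j hj
  have hj' : (0 : ℝ) < j := by exact_mod_cast hj
  simp only [Function.comp]
  push_cast
  rw [div_le_div_iff₀ hk' (by positivity)]
  have hent : j * (-Real.log κ) ≤ shannonEntropy (p (k * j)) := by
    have h1 : j * (-Real.log κ) = ∑' x, p (k * j) x * (j * (-Real.log κ)) := by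
      rw [tsum_mul_right, h.tsum_eq, one_mul]
    rw [h1, shannonEntropy]
    refine Summable.tsum_le_tsum (fun x => ?_) ((h.summable _).mul_right _) ?_
    · rw [Real.negMulLog, neg_mul_comm]
      rcases (h.nonneg (k * j) x).eq_or_lt with h0 | h0
      · rw [← h0]; simp
      · have := Real.log_le_log h0 (hb j x)
        rw [Real.log_pow] at this
        refine mul_le_mul_of_nonneg_left ?_ h0.le
        linarith
    · exact summable_of_hasFiniteSupport
        (HasFiniteSupport.of_eq_zero (h.hasFiniteSupport (k * j)) fun x hx => by simp [hx])
  nlinarith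

end IsDigitWalk
-- Fourier transforms and Farey energies
/-- The Fourier transform of a function on `ℤ`. -/
noncomputable def fourierZ (g : ℤ → ℝ) (θ : ℝ) : ℂ := ∑' k : ℤ, (g k : ℂ) * expCircle (k * θ)

lemma fourierZ_eq_sum {g : ℤ → ℝ} {I : Finset ℤ} (hI : ∀ k, k ∉ I → g k = 0) (θ : ℝ) :
    fourierZ g θ = ∑ k ∈ I, (g k : ℂ) * expCircle (k * θ) :=
  tsum_eq_sum fun k hk => by rw [hI k hk]; simp

lemma summable_fourierZ {g : ℤ → ℝ} (hg : g.HasFiniteSupport) (θ : ℝ) :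
    Summable fun k : ℤ => (g k : ℂ) * expCircle (k * θ) := by
  refine summable_of_hasFiniteSupport (Set.Finite.subset hg fun k hk => ?_)
  intro h0
  apply hk
  simp [h0]

lemma fourierZ_translate (g : ℤ → ℝ) (c : ℤ) (θ : ℝ) :
    fourierZ (fun x => g (x - c)) θ = expCircle (c * θ) * fourierZ g θ := by
  rw [fourierZ, fourierZ, ← tsum_mul_left,
    ← (Equiv.subRight c).tsum_eq fun x : ℤ => expCircle (c * θ) * ((g x : ℂ) * expCircle (x * θ))]
  refine tsum_congr fun x => ?_
  simp only [Equiv.subRight_apply]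
  rw [mul_left_comm, ← expCircle_add]
  congr 2
  push_cast
  ring

lemma fourierZ_sum_translate (S : Finset ℤ) (w : ℤ → ℝ) (c : ℤ) (g : ℤ → ℤ → ℝ)
    (hg : ∀ b ∈ S, (g b).HasFiniteSupport) (θ : ℝ) :
    fourierZ (fun x => ∑ b ∈ S, w b * g b (x - c * b)) θ =
      ∑ b ∈ S, w b * (expCircle ((c * b : ℤ) * θ) * fourierZ (g b) θ) := by
  have h1 : ∀ b ∈ S, Summable fun k : ℤ => (w b : ℂ) * ((g b (k - c * b) : ℂ) * expCircle (k * θ)) :=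
    fun b hb => (summable_fourierZ (hasFiniteSupport_translate (hg b hb) (c * b)) θ).mul_left _
  rw [fourierZ]
  push_cast
  simp only [Finset.sum_mul, mul_assoc]
  rw [Summable.tsum_finsetSum h1]
  refine Finset.sum_congr rfl fun b _ => ?_
  rw [tsum_mul_left]
  congr 1
  have := fourierZ_translate (g b) (c * b) θ
  rw [fourierZ] at this
  rw [this]
  push_cast
  ring_nf

lemma norm_fourierZ_le {g : ℤ → ℝ} (hg : g.HasFiniteSupport) (hg0 : ∀ x, 0 ≤ g x) (θ : ℝ) :
    ‖fourierZ g θ‖ ≤ ∑' x, g x := by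
  have h1 : ∀ x : ℤ, ‖(g x : ℂ) * expCircle (x * θ)‖ = g x := fun x => by
    rw [norm_mul, norm_expCircle, mul_one, Complex.norm_real, Real.norm_eq_abs,
      abs_of_nonneg (hg0 x)]
  have h2 := norm_tsum_le_tsum_norm (f := fun x : ℤ => (g x : ℂ) * expCircle (x * θ))
    (by simp only [h1]; exact summable_of_hasFiniteSupport hg)
  simp only [h1] at h2
  exact h2

/-- The Fourier transform `∑ b, w b * exp (2πibθ)` of the step distribution. -/
noncomputable def stepFourier (S : Finset ℤ) (w : ℤ → ℝ) (θ : ℝ) : ℂ :=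
  ∑ b ∈ S, (w b : ℂ) * expCircle (b * θ)

lemma fourierZ_translateAvg (S : Finset ℤ) (w : ℤ → ℝ) (c : ℤ) {g : ℤ → ℝ}
    (hg : g.HasFiniteSupport) (θ : ℝ) :
    fourierZ (translateAvg S w c g) θ = stepFourier S w (c * θ) * fourierZ g θ := by
  have := fourierZ_sum_translate S w c (fun _ => g) (fun _ _ => hg) θ
  rw [stepFourier, Finset.sum_mul]
  refine this.trans (Finset.sum_congr rfl fun b _ => ?_)
  rw [mul_assoc]
  congr 3
  push_cast
  ring

/-- The sum of `|ĝ|²` over the reduced fractions with denominator `d`. -/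
noncomputable def fareyEnergy (g : ℤ → ℝ) (d : ℕ) : ℝ :=
  ∑ r ∈ reducedNumerators d, ‖fourierZ g ((r : ℝ) / d)‖ ^ 2

lemma fareyEnergy_nonneg (g : ℤ → ℝ) (d : ℕ) : 0 ≤ fareyEnergy g d :=
  Finset.sum_nonneg fun _ _ => by positivity

/-! ### The killed walk and its energy -/

/-- The distribution of a digit walk killed on entering `Bad`. -/
noncomputable def killedWalk (a : ℕ) (S : Finset ℤ) (w : ℤ → ℝ) (Bad : ℕ → ℤ → Prop) :
    ℕ → ℤ → ℝ
  | 0 => fun x => if x = 0 then 1 else 0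
  | m + 1 => fun x => by
    classical exact if Bad (m + 1) x then 0 else translateAvg S w (a ^ m) (killedWalk a S w Bad m) x

lemma killedWalk_succ_of_bad {a : ℕ} {S : Finset ℤ} {w : ℤ → ℝ} {Bad : ℕ → ℤ → Prop} {m : ℕ} {x : ℤ}
    (hx : Bad (m + 1) x) : killedWalk a S w Bad (m + 1) x = 0 := by
  simp [killedWalk, hx]

lemma killedWalk_succ_of_not_bad {a : ℕ} {S : Finset ℤ} {w : ℤ → ℝ} {Bad : ℕ → ℤ → Prop} {m : ℕ}
    {x : ℤ} (hx : ¬ Bad (m + 1) x) :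
    killedWalk a S w Bad (m + 1) x = translateAvg S w (a ^ m) (killedWalk a S w Bad m) x := by
  simp [killedWalk, hx]

namespace IsDigitWalk

variable {a L : ℕ} {S : Finset ℤ} {w : ℤ → ℝ} {p : ℕ → ℤ → ℝ} {Bad : ℕ → ℤ → Prop}

lemma translateAvg_nonneg (h : IsDigitWalk a L S w p) {g : ℤ → ℝ} (hg : ∀ x, 0 ≤ g x) (c x : ℤ) :
    0 ≤ translateAvg S w c g x :=
  Finset.sum_nonneg fun b hb => mul_nonneg (h.pos b hb).le (hg _)

lemma translateAvg_mono (h : IsDigitWalk a L S w p) {g g' : ℤ → ℝ} (hg : ∀ x, g x ≤ g' x)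
    (c x : ℤ) : translateAvg S w c g x ≤ translateAvg S w c g' x :=
  Finset.sum_le_sum fun b hb => mul_le_mul_of_nonneg_left (hg _) (h.pos b hb).le

lemma killedWalk_nonneg (h : IsDigitWalk a L S w p) (m : ℕ) (x : ℤ) :
    0 ≤ killedWalk a S w Bad m x := by
  induction m generalizing x with
  | zero => simp only [killedWalk]; split_ifs <;> norm_num
  | succ m ih =>
    by_cases hx : Bad (m + 1) x
    · rw [killedWalk_succ_of_bad hx]
    · rw [killedWalk_succ_of_not_bad hx]
      exact h.translateAvg_nonneg ih _ _

lemma killedWalk_succ_le (h : IsDigitWalk a L S w p) (m : ℕ) (x : ℤ) :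
    killedWalk a S w Bad (m + 1) x ≤ translateAvg S w (a ^ m) (killedWalk a S w Bad m) x := by
  by_cases hx : Bad (m + 1) x
  · rw [killedWalk_succ_of_bad hx]
    exact h.translateAvg_nonneg (h.killedWalk_nonneg m) _ _
  · rw [killedWalk_succ_of_not_bad hx]

lemma killedWalk_le (h : IsDigitWalk a L S w p) (m : ℕ) (x : ℤ) :
    killedWalk a S w Bad m x ≤ p m x := by
  induction m generalizing x with
  | zero => rw [killedWalk, h.zero]
  | succ m ih =>
    rw [h.succ_eq]
    exact (h.killedWalk_succ_le m x).trans (h.translateAvg_mono ih _ _)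

lemma hasFiniteSupport_of_le (h : IsDigitWalk a L S w p) {m : ℕ} {g : ℤ → ℝ} (hg0 : ∀ x, 0 ≤ g x)
    (hg : ∀ x, g x ≤ p m x) : g.HasFiniteSupport :=
  HasFiniteSupport.of_eq_zero (h.hasFiniteSupport m) fun x hx =>
    le_antisymm (hx ▸ hg x) (hg0 x)

lemma hasFiniteSupport_killedWalk (h : IsDigitWalk a L S w p) (m : ℕ) :
    (killedWalk a S w Bad m).HasFiniteSupport :=
  h.hasFiniteSupport_of_le (h.killedWalk_nonneg m) (h.killedWalk_le m)

/-- Union bound: the mass killed at each time is at most what the full walk puts on the bad set at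
that time. -/
lemma tsum_killedWalk_ge (h : IsDigitWalk a L S w p) (m : ℕ) :
    1 - ∑ i ∈ Finset.range m, massOn (p (i + 1)) (Bad (i + 1)) ≤
      ∑' x, killedWalk a S w Bad m x := by
  classical
  induction m with
  | zero => simp [killedWalk]
  | succ m ih =>
    rw [Finset.sum_range_succ]
    have h1 := tsum_translateAvg (h.hasFiniteSupport_killedWalk (Bad := Bad) m) S w (a ^ m)
    rw [h.sum_eq, one_mul] at h1
    have h2 : ∑' x, translateAvg S w (a ^ m) (killedWalk a S w Bad m) x ≤
        ∑' x, (killedWalk a S w Bad (m + 1) x +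
          if Bad (m + 1) x then p (m + 1) x else 0) := by
      have hs1 := summable_of_hasFiniteSupport (L := SummationFilter.unconditional ℤ)
        (h.hasFiniteSupport_killedWalk (Bad := Bad) (m + 1))
      have hs2 : Summable fun x => if Bad (m + 1) x then p (m + 1) x else 0 :=
        summable_of_hasFiniteSupport
          (HasFiniteSupport.of_eq_zero (h.hasFiniteSupport (m + 1)) fun x hx => by simp [hx])
      refine Summable.tsum_le_tsum (fun x => ?_) ?_ (hs1.add hs2)
      · by_cases hx : Bad (m + 1) x
        · rw [killedWalk_succ_of_bad hx, if_pos hx, zero_add, h.succ_eq]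
          exact h.translateAvg_mono (h.killedWalk_le m) _ _
        · rw [killedWalk_succ_of_not_bad hx, if_neg hx, add_zero]
      · exact summable_of_hasFiniteSupport
          (hasFiniteSupport_translateAvg (h.hasFiniteSupport_killedWalk m) _ _ _)
    rw [Summable.tsum_add] at h2
    · have h3 : massOn (p (m + 1)) (Bad (m + 1)) =
          ∑' x, if Bad (m + 1) x then p (m + 1) x else 0 := by
        rw [massOn]
      rw [h3]
      linarith
    · exact summable_of_hasFiniteSupport (h.hasFiniteSupport_killedWalk (m + 1))
    · exact summable_of_hasFiniteSupport
        (HasFiniteSupport.of_eq_zero (h.hasFiniteSupport (m + 1)) fun x hx => by simp [hx])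

lemma tsum_killedWalk_le_one (h : IsDigitWalk a L S w p) (m : ℕ) :
    ∑' x, killedWalk a S w Bad m x ≤ 1 := by
  rw [← h.tsum_eq m]
  exact Summable.tsum_le_tsum (h.killedWalk_le m)
    (summable_of_hasFiniteSupport (h.hasFiniteSupport_killedWalk m)) (h.summable m)

/-- A bound for the energy of all functions dominated by the killed walk at time `m` propagates to
later times, since the energy is convex and invariant under translations. -/
lemma energy_le_of_le_killedWalk (h : IsDigitWalk a L S w p) {ι : Type*} (s : Finset ι)
    (θ : ι → ℝ) {B : ℝ} {m : ℕ}
    (hB : ∀ g : ℤ → ℝ, (∀ x, 0 ≤ g x) → (∀ x, g x ≤ killedWalk a S w Bad m x) →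
      ∑ i ∈ s, ‖fourierZ g (θ i)‖ ^ 2 ≤ B) (j : ℕ) (g : ℤ → ℝ) (hg0 : ∀ x, 0 ≤ g x)
    (hg : ∀ x, g x ≤ killedWalk a S w Bad (m + j) x) :
    ∑ i ∈ s, ‖fourierZ g (θ i)‖ ^ 2 ≤ B := by
  induction j generalizing g with
  | zero => exact hB g hg0 hg
  | succ j ih =>
    set f := killedWalk a S w Bad (m + j) with hf
    set c : ℤ := a ^ (m + j) with hc
    set t := translateAvg S w c f with ht
    have hgt : ∀ x, g x ≤ t x := fun x => (hg x).trans (h.killedWalk_succ_le (m + j) x)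
    have hf0 : ∀ x, 0 ≤ f x := h.killedWalk_nonneg (m + j)
    have ht0 : ∀ x, 0 ≤ t x := h.translateAvg_nonneg hf0 c
    -- Write g = u t with 0 ≤ u ≤ 1 and pull u back through each translate. This makes g a w-average
    -- of translates of functions `gb b` ≤ f, to which the induction hypothesis applies; translation
    -- leaves |ĝ| unchanged and Jensen handles the average.
    set u : ℤ → ℝ := fun x => g x / t x with hu
    have hu0 : ∀ x, 0 ≤ u x := fun x => div_nonneg (hg0 x) (ht0 x)
    have hu1 : ∀ x, u x ≤ 1 := fun x => div_le_one_of_le₀ (hgt x) (ht0 x)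
    set gb : ℤ → ℤ → ℝ := fun b z => f z * u (z + c * b) with hgb
    have hgb0 : ∀ b x, 0 ≤ gb b x := fun b x => mul_nonneg (hf0 x) (hu0 _)
    have hgbf : ∀ b x, gb b x ≤ f x := fun b x => mul_le_of_le_one_right (hf0 x) (hu1 _)
    have hgeq : g = fun x => ∑ b ∈ S, w b * gb b (x - c * b) := by
      funext x
      simp only [hgb, sub_add_cancel]
      have h1 : ∑ b ∈ S, w b * (f (x - c * b) * u x) = t x * u x := by
        rw [ht, translateAvg, Finset.sum_mul]
        exact Finset.sum_congr rfl fun b _ => by ring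
      rw [h1, hu]
      rcases eq_or_ne (t x) 0 with h0 | h0
      · have := hgt x
        rw [h0] at this ⊢
        rw [zero_mul]
        exact le_antisymm this (hg0 x)
      · simp only
        field_simp
    have hfs : ∀ b ∈ S, (gb b).HasFiniteSupport := fun b _ =>
      HasFiniteSupport.of_eq_zero (h.hasFiniteSupport_killedWalk (Bad := Bad) (m + j))
        fun x hx => by simp only [hgb]; rw [show f x = 0 from hx, zero_mul]
    have hpt : ∀ i ∈ s, ‖fourierZ g (θ i)‖ ^ 2 ≤ ∑ b ∈ S, w b * ‖fourierZ (gb b) (θ i)‖ ^ 2 := by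
      intro i _
      have h1 : ‖fourierZ g (θ i)‖ ≤ ∑ b ∈ S, w b * ‖fourierZ (gb b) (θ i)‖ := by
        rw [hgeq, fourierZ_sum_translate S w c gb hfs]
        refine (norm_sum_le _ _).trans (Finset.sum_le_sum fun b hb => le_of_eq ?_)
        rw [norm_mul, norm_mul, norm_expCircle, one_mul, Complex.norm_real, Real.norm_eq_abs,
          abs_of_pos (h.pos b hb)]
      refine (pow_le_pow_left₀ (norm_nonneg _) h1 2).trans ?_
      exact Real.pow_arith_mean_le_arith_mean_pow S w _ (fun b hb => (h.pos b hb).le) h.sum_eq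
        (fun b _ => norm_nonneg _) 2
    refine (Finset.sum_le_sum hpt).trans ?_
    rw [Finset.sum_comm]
    simp only [← Finset.mul_sum]
    calc ∑ b ∈ S, w b * ∑ i ∈ s, ‖fourierZ (gb b) (θ i)‖ ^ 2 ≤ ∑ b ∈ S, w b * B :=
          Finset.sum_le_sum fun b hb =>
            mul_le_mul_of_nonneg_left (ih (gb b) (hgb0 b) (hgbf b)) (h.pos b hb).le
      _ = B := by rw [← Finset.sum_mul, h.sum_eq, one_mul]

/-- The large sieve, combined with ∑ g² ≤ M ∑ p_m = M. -/
lemma sum_fareyEnergy_le_of_le (h : IsDigitWalk a L S w p) {m D W : ℕ} (hDW : D ^ 2 ≤ W)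
    (hLW : L * a ^ m ≤ W) {g : ℤ → ℝ} (hg0 : ∀ x, 0 ≤ g x) (hg : ∀ x, g x ≤ p m x) {M : ℝ}
    (hM : ∀ x, g x ≤ M) : ∑ d ∈ Finset.Icc 1 D, fareyEnergy g d ≤ 9 * W * M := by
  have hI : ∀ k, k ∉ Finset.Icc (-W : ℤ) W → g k = 0 := by
    intro k hk
    by_contra h0
    have h1 : p m k ≠ 0 := fun h1 => h0 (le_antisymm (h1 ▸ hg k) (hg0 k))
    have h2 := h.abs_le_of_ne_zero h1
    have h3 : (L : ℤ) * a ^ m ≤ W := by exact_mod_cast hLW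
    exact hk (Finset.mem_Icc.2 (_root_.abs_le.1 (h2.trans h3)))
  have hls := large_sieve_farey D W hDW g
  simp only [← fourierZ_eq_sum hI] at hls
  refine hls.trans ?_
  have hsq : ∑ k ∈ Finset.Icc (-W : ℤ) W, g k ^ 2 ≤ M := by
    have hM0 : 0 ≤ M := (hg0 0).trans (hM 0)
    calc ∑ k ∈ Finset.Icc (-W : ℤ) W, g k ^ 2 ≤ ∑ k ∈ Finset.Icc (-W : ℤ) W, M * p m k := by
          refine Finset.sum_le_sum fun k _ => ?_
          rw [sq]
          exact mul_le_mul (hM k) (hg k) (hg0 k) hM0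
      _ = M * ∑ k ∈ Finset.Icc (-W : ℤ) W, p m k := by rw [Finset.mul_sum]
      _ ≤ M * 1 := by
          refine mul_le_mul_of_nonneg_left ?_ hM0
          rw [← h.tsum_eq m]
          exact (h.summable m).sum_le_tsum _ fun x _ => h.nonneg m x
      _ = M := mul_one M
  exact mul_le_mul_of_nonneg_left hsq (by positivity)

end IsDigitWalk

/-- The points visited with atypically large probability, at times between `m₀` and `N`. -/
def atypical (p : ℕ → ℤ → ℝ) (E : ℝ) (m₀ N m : ℕ) (x : ℤ) : Prop :=
  m₀ ≤ m ∧ m ≤ N ∧ Real.exp (-(E * m)) < p m x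

namespace IsDigitWalk

variable {a L : ℕ} {S : Finset ℤ} {w : ℤ → ℝ} {p : ℕ → ℤ → ℝ}

lemma killedWalk_atypical_le (h : IsDigitWalk a L S w p) {E : ℝ} {m₀ N m : ℕ} (h1 : 1 ≤ m₀)
    (hm₀ : m₀ ≤ m) (hmN : m ≤ N) (x : ℤ) :
    killedWalk a S w (atypical p E m₀ N) m x ≤ Real.exp (-(E * m)) := by
  -- Nothing is killed at time 0, hence the requirement m₀ ≥ 1.
  obtain ⟨m, rfl⟩ : ∃ k, m = k + 1 := ⟨m - 1, by omega⟩
  by_cases hx : atypical p E m₀ N (m + 1) x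
  · rw [killedWalk_succ_of_bad hx]
    exact (Real.exp_pos _).le
  · refine (h.killedWalk_le _ x).trans ?_
    by_contra hcon
    exact hx ⟨hm₀, hmN, not_le.1 hcon⟩

/-- Apply the large sieve at an intermediate time m with a^m ≤ D², where the point masses are at
most exp(-Em), then transport the bound to time n. -/
theorem sum_fareyEnergy_killedWalk_le (h : IsDigitWalk a L S w p) {E c : ℝ} (hE : 0 < E)
    (hc : (1 + c) * Real.log a ≤ 2 * E) {m₀ N n D : ℕ} (h1 : 1 ≤ m₀) (hm₀N : m₀ ≤ N)
    (hNn : N ≤ n) (hD : a ^ m₀ ≤ D) (hDN : (1 + c) * Real.log D ≤ E * N) :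
    ∑ d ∈ Finset.Icc 1 D, fareyEnergy (killedWalk a S w (atypical p E m₀ N) n) d ≤
      9 * L * Real.exp E * (D : ℝ) ^ (1 - c) := by
  have ha := h.one_lt
  have hapos : 0 < a := by omega
  have hD0 : 0 < D := lt_of_lt_of_le (by positivity) hD
  have hD0' : (0 : ℝ) < D := by exact_mod_cast hD0
  have hDD : D ≤ D ^ 2 := Nat.le_self_pow (by norm_num) D
  -- The latest time at most N at which a^m still fits under D². Waiting longer would enlarge the
  -- range; stopping earlier would leave larger point masses.
  set m := min (Nat.log a (D ^ 2)) N with hm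
  have hmm₀ : m₀ ≤ m := by
    refine le_min ?_ hm₀N
    exact Nat.le_log_of_pow_le ha (hD.trans hDD)
  have hmN : m ≤ N := min_le_right _ _
  have ham : a ^ m ≤ D ^ 2 :=
    (Nat.pow_le_pow_right hapos (min_le_left _ _)).trans (Nat.pow_log_le_self a (by positivity))
  -- If m is the logarithm, `hc` gives this, and exp E pays for rounding down. If m = N, `hDN` does.
  have hexp : Real.exp (-(E * m)) ≤ Real.exp E * (D : ℝ) ^ (-1 - c) := by
    rw [Real.rpow_def_of_pos hD0', ← Real.exp_add, Real.exp_le_exp]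
    rcases le_total (Nat.log a (D ^ 2)) N with hle | hle
    · rw [hm, min_eq_left hle]
      have h2 : D ^ 2 < a ^ (Nat.log a (D ^ 2) + 1) := Nat.lt_pow_succ_log_self ha _
      have h3 : ((D : ℝ)) ^ 2 < (a : ℝ) ^ (Nat.log a (D ^ 2) + 1) := by exact_mod_cast h2
      have h4 := Real.log_lt_log (by positivity) h3
      rw [Real.log_pow, Real.log_pow] at h4
      push_cast at h4
      have hla : 0 < Real.log a := Real.log_pos (by exact_mod_cast ha)
      have hlD : 0 ≤ Real.log D := Real.log_natCast_nonneg D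
      set y : ℝ := (Nat.log a (D ^ 2) : ℝ) with hy
      have hy0 : 0 ≤ y := Nat.cast_nonneg _
      have h5 : (1 + c) * Real.log D ≤ E * (y + 1) := by
        rcases le_or_gt (1 + c) 0 with hc0 | hc0
        · nlinarith
        · have : (1 + c) * (2 * Real.log D) ≤ (1 + c) * ((y + 1) * Real.log a) := by gcongr
          have : (1 + c) * Real.log a * (y + 1) ≤ 2 * E * (y + 1) := by gcongr
          linarith
      linarith
    · rw [hm, min_eq_right hle]
      linarith
  obtain ⟨j, rfl⟩ := Nat.exists_eq_add_of_le (hmN.trans hNn)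
  have hkey := h.energy_le_of_le_killedWalk (Bad := atypical p E m₀ N) (m := m)
    ((Finset.Icc 1 D).sigma reducedNumerators) (fun i => (i.2 : ℝ) / i.1)
    (B := 9 * (L * D ^ 2 : ℕ) * Real.exp (-(E * m))) (fun g hg0 hg => by
      rw [Finset.sum_sigma]
      refine h.sum_fareyEnergy_le_of_le (m := m) ?_ ?_ hg0
        (fun x => (hg x).trans (h.killedWalk_le m x))
        (fun x => (hg x).trans (h.killedWalk_atypical_le h1 hmm₀ hmN x))
      · exact Nat.le_mul_of_pos_left _ h.one_le
      · gcongr) j _ (h.killedWalk_nonneg _) (fun x => le_rfl)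
  rw [Finset.sum_sigma] at hkey
  refine hkey.trans ?_
  calc 9 * ((L * D ^ 2 : ℕ) : ℝ) * Real.exp (-(E * m))
      ≤ 9 * ((L * D ^ 2 : ℕ) : ℝ) * (Real.exp E * (D : ℝ) ^ (-1 - c)) := by gcongr
    _ = 9 * L * Real.exp E * ((D : ℝ) ^ (2 : ℝ) * (D : ℝ) ^ (-1 - c)) := by
        push_cast
        rw [Real.rpow_two]
        ring
    _ = 9 * L * Real.exp E * (D : ℝ) ^ (1 - c) := by
        rw [← Real.rpow_add hD0']
        congr 2
        ring

/-! ### Contraction at small denominators -/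

lemma norm_stepFourier_lt_one (h : IsDigitWalk a L S w p) {θ : ℝ} {b₁ b₂ : ℤ} (h₁ : b₁ ∈ S)
    (h₂ : b₂ ∈ S) (hne : expCircle (b₁ * θ) ≠ expCircle (b₂ * θ)) : ‖stepFourier S w θ‖ < 1 := by
  classical
  have hb : b₁ ≠ b₂ := fun hb => hne (by rw [hb])
  have h₂' : b₂ ∈ S.erase b₁ := Finset.mem_erase.2 ⟨hb.symm, h₂⟩
  have hnorm : ∀ b ∈ S, ‖(w b : ℂ) * expCircle (b * θ)‖ = w b := fun b hb => by
    rw [norm_mul, norm_expCircle, mul_one, Complex.norm_real, Real.norm_eq_abs,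
      abs_of_pos (h.pos b hb)]
  have hrest : ‖∑ b ∈ (S.erase b₁).erase b₂, (w b : ℂ) * expCircle (b * θ)‖ ≤
      ∑ b ∈ (S.erase b₁).erase b₂, w b :=
    (norm_sum_le _ _).trans (Finset.sum_le_sum fun b hb =>
      (hnorm b (Finset.mem_of_mem_erase (Finset.mem_of_mem_erase hb))).le)
  have hsum : w b₁ + (w b₂ + ∑ b ∈ (S.erase b₁).erase b₂, w b) = 1 := by
    rw [Finset.add_sum_erase _ _ h₂', Finset.add_sum_erase _ _ h₁, h.sum_eq]
  have hray : ¬ SameRay ℝ ((w b₁ : ℂ) * expCircle (b₁ * θ)) ((w b₂ : ℂ) * expCircle (b₂ * θ)) := by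
    intro hs
    have hs' := hs.norm_smul_eq
    rw [hnorm _ h₁, hnorm _ h₂] at hs'
    simp only [Complex.real_smul] at hs'
    have hw1 : (w b₁ : ℂ) ≠ 0 := by exact_mod_cast (h.pos _ h₁).ne'
    have hw2 : (w b₂ : ℂ) ≠ 0 := by exact_mod_cast (h.pos _ h₂).ne'
    apply hne
    apply mul_left_cancel₀ (mul_ne_zero hw1 hw2)
    linear_combination -hs'
  have hlt := norm_add_lt_of_not_sameRay hray
  rw [hnorm _ h₁, hnorm _ h₂] at hlt
  rw [stepFourier, ← Finset.add_sum_erase _ _ h₁, ← Finset.add_sum_erase _ _ h₂', ← add_assoc]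
  have := norm_add_le ((w b₁ : ℂ) * expCircle (b₁ * θ) + (w b₂ : ℂ) * expCircle (b₂ * θ))
    (∑ b ∈ (S.erase b₁).erase b₂, (w b : ℂ) * expCircle (b * θ))
  linarith

/-- Otherwise strictness of the triangle inequality makes all phases equal, so d divides (x - y)t
for all digits x, y. Then d / gcd(d, t) divides every digit difference, hence is 1, and d divides t.
-/
lemma norm_stepFourier_div_lt_one (h : IsDigitWalk a L S w p)
    (hgcd : ∀ d : ℕ, (∀ x ∈ S, ∀ y ∈ S, (d : ℤ) ∣ x - y) → d = 1) {d : ℕ} (hd : 0 < d) {t : ℤ}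
    (ht : ¬ (d : ℤ) ∣ t) : ‖stepFourier S w ((t : ℝ) / d)‖ < 1 := by
  by_contra hcon
  have hall : ∀ x ∈ S, ∀ y ∈ S, (d : ℤ) ∣ (x - y) * t := by
    intro x hx y hy
    by_contra hdvd
    apply hcon
    refine h.norm_stepFourier_lt_one hx hy fun he => hdvd ?_
    have hd' : (d : ℝ) ≠ 0 := by exact_mod_cast hd.ne'
    have h1 : expCircle ((x - y : ℤ) * ((t : ℝ) / d)) = 1 := by
      have : ((x - y : ℤ) : ℝ) * ((t : ℝ) / d) = x * (t / d) + -(y * (t / d)) := by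
        push_cast; ring
      rw [this, expCircle_add, he, ← expCircle_add, add_neg_cancel, expCircle_zero]
    obtain ⟨k, hk⟩ := (expCircle_eq_one_iff _).1 h1
    refine ⟨k, ?_⟩
    have h2 : ((x - y : ℤ) : ℝ) * t = d * k := by
      rw [← hk]
      field_simp
    exact_mod_cast h2
  set g := Int.gcd d t with hg
  have hg0 : 0 < g := Int.gcd_pos_of_ne_zero_left _ (by exact_mod_cast hd.ne')
  have hgd : g ∣ d := by exact_mod_cast Int.gcd_dvd_left (d : ℤ) t
  obtain ⟨d', hd'⟩ := hgd
  obtain ⟨t', ht'⟩ := Int.gcd_dvd_right (d : ℤ) t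
  rw [← hg] at ht'
  have hcop : IsCoprime (d' : ℤ) t' := by
    rw [Int.isCoprime_iff_gcd_eq_one]
    have h1 : Int.gcd (g * d' : ℤ) (g * t') = g * Int.gcd d' t' := by
      rw [Int.gcd_mul_left]; simp
    have h2 : ((g : ℤ) * d') = d := by exact_mod_cast hd'.symm
    rw [h2, ← ht', ← hg] at h1
    exact Nat.eq_of_mul_eq_mul_left hg0 (by linarith)
  have h1 : d' = 1 := by
    refine hgcd d' fun x hx y hy => ?_
    have h2 := hall x hx y hy
    rw [hd', ht'] at h2
    push_cast at h2
    rw [mul_left_comm] at h2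
    exact hcop.dvd_of_dvd_mul_right (Int.dvd_of_mul_dvd_mul_left (by exact_mod_cast hg0.ne') h2)
  rw [h1, mul_one] at hd'
  apply ht
  rw [hd', ht']
  exact dvd_mul_right _ _

lemma exists_norm_stepFourier_le (h : IsDigitWalk a L S w p)
    (hgcd : ∀ d : ℕ, (∀ x ∈ S, ∀ y ∈ S, (d : ℤ) ∣ x - y) → d = 1) (D : ℕ) :
    ∃ κ : ℝ, 0 ≤ κ ∧ κ < 1 ∧ ∀ d : ℕ, 0 < d → d ≤ D → ∀ t : ℤ, ¬ (d : ℤ) ∣ t →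
      ‖stepFourier S w ((t : ℝ) / d)‖ ≤ κ := by
  classical
  set T : Finset ℝ := insert 0 ((((Finset.Icc 1 D).sigma fun d => Finset.range d).filter
    fun i => ¬ i.1 ∣ i.2).image fun i => ‖stepFourier S w ((i.2 : ℝ) / i.1)‖) with hT
  -- Only finitely many values occur, since the transform at t/d depends on t modulo d; the inserted
  -- 0 makes the maximum exist and be nonnegative.
  have hne : T.Nonempty := ⟨0, Finset.mem_insert_self _ _⟩
  refine ⟨T.max' hne, T.le_max' 0 (Finset.mem_insert_self _ _), ?_, ?_⟩
  · rw [Finset.max'_lt_iff]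
    intro y hy
    rcases Finset.mem_insert.1 hy with rfl | hy
    · norm_num
    · obtain ⟨⟨d, r⟩, hi, rfl⟩ := Finset.mem_image.1 hy
      simp only [Finset.mem_filter, Finset.mem_sigma, Finset.mem_Icc] at hi
      have := h.norm_stepFourier_div_lt_one hgcd (d := d) (t := r) (by omega)
        (by exact_mod_cast hi.2)
      simpa using this
  · intro d hd hdD t ht
    have hd' : (d : ℤ) ≠ 0 := by exact_mod_cast hd.ne'
    have hdr : (d : ℝ) ≠ 0 := by exact_mod_cast hd.ne'
    obtain ⟨r, hr⟩ : ∃ r : ℕ, t % d = r := Int.eq_ofNat_of_zero_le (Int.emod_nonneg t hd')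
    have hrd : r < d := by
      have := Int.emod_lt_of_pos t (by exact_mod_cast hd : (0 : ℤ) < d)
      omega
    have hmod := Int.emod_add_mul_ediv t d
    have heq : stepFourier S w ((t : ℝ) / d) = stepFourier S w ((r : ℝ) / d) := by
      rw [stepFourier, stepFourier]
      refine Finset.sum_congr rfl fun b _ => ?_
      congr 1
      have h1 : (t : ℝ) = r + d * (t / d : ℤ) := by
        rw [hr] at hmod
        exact_mod_cast hmod.symm
      have h2 : (b : ℝ) * ((t : ℝ) / d) = b * (r / d) + ((b * (t / d) : ℤ) : ℝ) := by
        rw [h1]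
        push_cast
        field_simp
      rw [h2, expCircle_add_int]
    rw [heq]
    refine T.le_max' _ (Finset.mem_insert_of_mem (Finset.mem_image.2 ⟨⟨d, r⟩, ?_, rfl⟩))
    simp only [Finset.mem_filter, Finset.mem_sigma, Finset.mem_Icc, Finset.mem_range]
    refine ⟨⟨⟨hd, hdD⟩, hrd⟩, fun hdvd => ht ?_⟩
    rw [← hmod, hr]
    exact dvd_add (by exact_mod_cast hdvd) (dvd_mul_right _ _)

/-- After time N the steps are plain convolutions, so each multiplies the transform at r/d by the
step transform at a^i r/d. Coprimality of d to a and r keeps d from dividing a^i r. -/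
lemma norm_fourierZ_killedWalk_le (h : IsDigitWalk a L S w p) {Bad : ℕ → ℤ → Prop} {N : ℕ}
    (hBad : ∀ m x, N < m → ¬ Bad m x) {κ : ℝ} {d r : ℕ}
    (hκ : ∀ t : ℤ, ¬ (d : ℤ) ∣ t → ‖stepFourier S w ((t : ℝ) / d)‖ ≤ κ) (hd : 1 < d)
    (hda : d.Coprime a) (hr : r.Coprime d) (K : ℕ) :
    ‖fourierZ (killedWalk a S w Bad (N + K)) ((r : ℝ) / d)‖ ≤ κ ^ K := by
  induction K with
  | zero =>
    exact (norm_fourierZ_le (h.hasFiniteSupport_killedWalk _) (h.killedWalk_nonneg _) _).trans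
      ((h.tsum_killedWalk_le_one _).trans_eq (pow_zero κ).symm)
  | succ K ih =>
    have h1 : killedWalk a S w Bad (N + (K + 1)) =
        translateAvg S w (a ^ (N + K)) (killedWalk a S w Bad (N + K)) := by
      funext x
      exact killedWalk_succ_of_not_bad (hBad (N + K + 1) x (by omega))
    have h2 := hκ (a ^ (N + K) * r) (by
      intro hdvd
      have h3 : d ∣ a ^ (N + K) * r := by exact_mod_cast hdvd
      have h4 := (Nat.Coprime.pow_right (N + K) hda).mul_right hr.symm
      have := Nat.Coprime.eq_one_of_dvd h4 h3
      omega)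
    have hκ0 : 0 ≤ κ := (norm_nonneg _).trans h2
    rw [h1, fourierZ_translateAvg S w _ (h.hasFiniteSupport_killedWalk _), norm_mul, pow_succ']
    refine mul_le_mul ?_ ih (norm_nonneg _) hκ0
    have h5 : (((a : ℤ) ^ (N + K) : ℤ) : ℝ) * ((r : ℝ) / d) =
        ((((a : ℤ) ^ (N + K) * r : ℤ)) : ℝ) / d := by
      push_cast
      ring
    rw [h5]
    exact h2

end IsDigitWalk
-- Reduction modulo q and distance to uniform
/-- The mass of a residue class modulo `q`. -/
noncomputable def residueMass (g : ℤ → ℝ) (q : ℕ) (x : ZMod q) : ℝ :=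
  ∑' k : ℤ, if (k : ZMod q) = x then g k else 0

lemma residueMass_eq_sum {g : ℤ → ℝ} {I : Finset ℤ} (hI : ∀ k, k ∉ I → g k = 0) (q : ℕ)
    (x : ZMod q) : residueMass g q x = ∑ k ∈ I, if (k : ZMod q) = x then g k else 0 :=
  tsum_eq_sum fun k hk => by rw [hI k hk]; simp

lemma distUniform_eq_sum (P : PMF ℤ) (q : ℕ) [NeZero q] :
    distUniform P q = ∑ x : ZMod q, |residueMass (fun k => (P k).toReal) q x - 1 / (q : ℝ)| := by
  rw [distUniform, tsum_fintype]
  refine Finset.sum_congr rfl fun x _ => ?_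
  rw [PMF.map_apply, ENNReal.tsum_toReal_eq]
  · congr 2
    refine tsum_congr fun k => ?_
    by_cases h : (k : ZMod q) = x
    · simp [h]
    · rw [if_neg h, if_neg fun h' => h h'.symm]; rfl
  · intro k
    split_ifs
    · exact PMF.apply_ne_top _ _
    · exact ENNReal.zero_ne_top

lemma sum_residueMass {g : ℤ → ℝ} (hg : g.HasFiniteSupport) (q : ℕ) [NeZero q] :
    ∑ x : ZMod q, residueMass g q x = ∑' k, g k := by
  have hI : ∀ k, k ∉ supportFinset hg → g k = 0 := fun k hk => by
    rwa [mem_supportFinset, not_not] at hk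
  simp only [residueMass_eq_sum hI]
  rw [Finset.sum_comm, tsum_eq_sum hI]
  exact Finset.sum_congr rfl fun k _ => by simp

lemma residueMass_nonneg {g : ℤ → ℝ} (hg : ∀ k, 0 ≤ g k) (q : ℕ) (x : ZMod q) :
    0 ≤ residueMass g q x :=
  tsum_nonneg fun k => by split_ifs; exacts [hg k, le_rfl]

lemma residueMass_mono {g g' : ℤ → ℝ} (hg : g.HasFiniteSupport) (hg' : g'.HasFiniteSupport)
    (h : ∀ k, g k ≤ g' k) (q : ℕ) (x : ZMod q) : residueMass g q x ≤ residueMass g' q x := by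
  refine Summable.tsum_le_tsum (fun k => ?_) ?_ ?_
  · split_ifs
    exacts [h k, le_rfl]
  · exact summable_of_hasFiniteSupport (HasFiniteSupport.of_eq_zero hg fun k hk => by simp [hk])
  · exact summable_of_hasFiniteSupport (HasFiniteSupport.of_eq_zero hg' fun k hk => by simp [hk])

lemma sum_expCircle_div (q : ℕ) [NeZero q] (k : ℤ) :
    ∑ r ∈ Finset.range q, expCircle (k * ((r : ℝ) / q)) = if (k : ZMod q) = 0 then (q : ℂ) else 0 := by
  have hq : (q : ℝ) ≠ 0 := by exact_mod_cast NeZero.ne q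
  have h1 : ∀ r ∈ Finset.range q, expCircle (k * ((r : ℝ) / q)) = expCircle (k / q) ^ r := by
    intro r _
    rw [← expCircle_natCast_mul]
    congr 1
    field_simp
  rw [Finset.sum_congr rfl h1]
  split_ifs with h
  · rw [ZMod.intCast_zmod_eq_zero_iff_dvd] at h
    have : expCircle ((k : ℝ) / q) = 1 := by
      rw [expCircle_eq_one_iff]
      obtain ⟨j, rfl⟩ := h
      exact ⟨j, by push_cast; field_simp⟩
    simp [this]
  · have hne : expCircle ((k : ℝ) / q) ≠ 1 := by
      intro h1
      obtain ⟨j, hj⟩ := (expCircle_eq_one_iff _).1 h1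
      apply h
      rw [ZMod.intCast_zmod_eq_zero_iff_dvd]
      refine ⟨j, ?_⟩
      rw [div_eq_iff hq, mul_comm] at hj
      exact_mod_cast hj
    rw [geom_sum_eq hne, ← expCircle_natCast_mul, mul_div_cancel₀ _ hq, expCircle_int, sub_self,
      zero_div]

/-- Parseval's identity modulo `q`. -/
lemma sum_norm_sq_fourierZ {g : ℤ → ℝ} (hg : g.HasFiniteSupport) (q : ℕ) [NeZero q] :
    ∑ r ∈ Finset.range q, ‖fourierZ g ((r : ℝ) / q)‖ ^ 2 =
      q * ∑ x : ZMod q, residueMass g q x ^ 2 := by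
  have hI : ∀ k, k ∉ supportFinset hg → g k = 0 := fun k hk => by
    rwa [mem_supportFinset, not_not] at hk
  set I := supportFinset hg with hIdef
  have h1 : ((∑ r ∈ Finset.range q, ‖fourierZ g ((r : ℝ) / q)‖ ^ 2 : ℝ) : ℂ) =
      ∑ k ∈ I, ∑ l ∈ I, (g k : ℂ) * g l * if ((k - l : ℤ) : ZMod q) = 0 then (q : ℂ) else 0 := by
    push_cast
    have h2 : ∀ r ∈ Finset.range q, ((‖fourierZ g ((r : ℝ) / q)‖ : ℝ) : ℂ) ^ 2 =
        ∑ k ∈ I, ∑ l ∈ I, (g k : ℂ) * g l * expCircle ((k - l : ℤ) * ((r : ℝ) / q)) := by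
      intro r _
      rw [← Complex.mul_conj', fourierZ_eq_sum hI, map_sum, Finset.sum_mul_sum]
      refine Finset.sum_congr rfl fun k _ => Finset.sum_congr rfl fun l _ => ?_
      rw [map_mul, Complex.conj_ofReal, ← expCircle_neg, mul_mul_mul_comm, ← expCircle_add]
      congr 2
      push_cast
      ring
    rw [Finset.sum_congr rfl h2, Finset.sum_comm]
    refine Finset.sum_congr rfl fun k _ => ?_
    rw [Finset.sum_comm]
    refine Finset.sum_congr rfl fun l _ => ?_
    rw [← Finset.mul_sum, sum_expCircle_div]
    push_cast
    rfl
  have h3 : ((q * ∑ x : ZMod q, residueMass g q x ^ 2 : ℝ) : ℂ) =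
      ∑ k ∈ I, ∑ l ∈ I, (g k : ℂ) * g l * if ((k - l : ℤ) : ZMod q) = 0 then (q : ℂ) else 0 := by
    have h4 : ∀ x : ZMod q, residueMass g q x ^ 2 = ∑ k ∈ I, ∑ l ∈ I,
        g k * g l * ((if (k : ZMod q) = x then 1 else 0) * if (l : ZMod q) = x then 1 else 0) := by
      intro x
      rw [residueMass_eq_sum hI, sq, Finset.sum_mul_sum]
      refine Finset.sum_congr rfl fun k _ => Finset.sum_congr rfl fun l _ => ?_
      split_ifs <;> simp
    have h5 : ∑ x : ZMod q, residueMass g q x ^ 2 = ∑ k ∈ I, ∑ l ∈ I,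
        g k * g l * if ((k - l : ℤ) : ZMod q) = 0 then 1 else 0 := by
      simp only [h4]
      rw [Finset.sum_comm]
      refine Finset.sum_congr rfl fun k _ => ?_
      rw [Finset.sum_comm]
      refine Finset.sum_congr rfl fun l _ => ?_
      rw [← Finset.mul_sum]
      congr 1
      simp only [ite_mul, one_mul, zero_mul, Finset.sum_ite_eq, Finset.mem_univ, if_true]
      push_cast
      simp only [sub_eq_zero, eq_comm]
    rw [h5]
    push_cast
    rw [Finset.mul_sum]
    refine Finset.sum_congr rfl fun k _ => ?_
    rw [Finset.mul_sum]
    refine Finset.sum_congr rfl fun l _ => ?_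
    split_ifs <;> simp
    ring
  exact_mod_cast h1.trans h3.symm

lemma fourierZ_zero (g : ℤ → ℝ) : fourierZ g 0 = ((∑' k, g k : ℝ) : ℂ) := by
  rw [fourierZ, Complex.ofReal_tsum]
  refine tsum_congr fun k => ?_
  rw [mul_zero, expCircle_zero, mul_one]

/-- The sum of `|ĝ(r/q)|²` over the nontrivial frequencies modulo `q`. -/
noncomputable def modEnergy (g : ℤ → ℝ) (q : ℕ) : ℝ :=
  ∑ r ∈ (Finset.range q).erase 0, ‖fourierZ g ((r : ℝ) / q)‖ ^ 2

lemma modEnergy_nonneg (g : ℤ → ℝ) (q : ℕ) : 0 ≤ modEnergy g q :=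
  Finset.sum_nonneg fun _ _ => by positivity

/-- Cauchy–Schwarz over the q residues, then Parseval; subtracting the mean removes the zero
frequency. -/
lemma sum_abs_residueMass_sub_le {g : ℤ → ℝ} (hg : g.HasFiniteSupport) (q : ℕ) [NeZero q] :
    ∑ x : ZMod q, |residueMass g q x - (∑' k, g k) / q| ≤ √(modEnergy g q) := by
  have hq : (q : ℝ) ≠ 0 := by exact_mod_cast NeZero.ne q
  set F := ∑' k, g k with hF
  have h0 : 0 ∈ Finset.range q := Finset.mem_range.2 (Nat.pos_of_ne_zero (NeZero.ne q))
  have h1 : modEnergy g q = q * ∑ x : ZMod q, residueMass g q x ^ 2 - F ^ 2 := by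
    rw [← sum_norm_sq_fourierZ hg, ← Finset.add_sum_erase _ _ h0, modEnergy]
    rw [Nat.cast_zero, zero_div, fourierZ_zero, Complex.norm_real, Real.norm_eq_abs, sq_abs]
    ring
  have h2 : ∑ x : ZMod q, (residueMass g q x - F / q) ^ 2 =
      ∑ x : ZMod q, residueMass g q x ^ 2 - F ^ 2 / q := by
    simp only [sub_sq, Finset.sum_add_distrib, Finset.sum_sub_distrib]
    rw [← Finset.sum_mul, ← Finset.mul_sum, sum_residueMass hg, Finset.sum_const, Finset.card_univ,
      ZMod.card, nsmul_eq_mul]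
    field_simp
    ring
  refine Real.le_sqrt_of_sq_le ?_
  have h3 := sq_sum_le_card_mul_sum_sq (s := (Finset.univ : Finset (ZMod q)))
    (f := fun x => |residueMass g q x - F / q|)
  simp only [sq_abs, Finset.card_univ, ZMod.card] at h3
  refine h3.trans_eq ?_
  rw [h1, h2]
  field_simp

/-- Replacing P by g costs the missing mass once in the residue masses and once in the uniform part.
-/
lemma distUniform_le {P : PMF ℤ} (hP : (fun k => (P k).toReal).HasFiniteSupport) {g : ℤ → ℝ}
    (hg0 : ∀ k, 0 ≤ g k) (hg : ∀ k, g k ≤ (P k).toReal) (q : ℕ) [NeZero q] :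
    distUniform P q ≤ √(modEnergy g q) + 2 * (1 - ∑' k, g k) := by
  have hq : (q : ℝ) ≠ 0 := by exact_mod_cast NeZero.ne q
  have hgs : g.HasFiniteSupport := HasFiniteSupport.of_eq_zero hP fun x hx =>
    le_antisymm (hx ▸ hg x) (hg0 x)
  have hP1 : ∑' k, (P k).toReal = 1 := by
    rw [← ENNReal.tsum_toReal_eq fun k => PMF.apply_ne_top _ _, PMF.tsum_coe, ENNReal.toReal_one]
  set F := ∑' k, g k with hF
  have hF1 : F ≤ 1 := by
    rw [← hP1]
    exact Summable.tsum_le_tsum hg (summable_of_hasFiniteSupport hgs)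
      (summable_of_hasFiniteSupport hP)
  rw [distUniform_eq_sum]
  have hpt : ∀ x : ZMod q, |residueMass (fun k => (P k).toReal) q x - 1 / (q : ℝ)| ≤
      (residueMass (fun k => (P k).toReal) q x - residueMass g q x) +
        |residueMass g q x - F / q| + (1 - F) / q := by
    intro x
    have h1 := residueMass_mono hgs hP hg q x
    have h2 : 0 ≤ (1 - F) / q := div_nonneg (by linarith) (Nat.cast_nonneg q)
    have h3 := abs_le.1 (le_refl |residueMass g q x - F / q|)
    rw [sub_div] at h2 ⊢
    rw [abs_le]
    constructor <;> linarith
  refine (Finset.sum_le_sum fun x _ => hpt x).trans ?_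
  rw [Finset.sum_add_distrib, Finset.sum_add_distrib, Finset.sum_sub_distrib, sum_residueMass hP,
    sum_residueMass hgs, hP1, Finset.sum_const, Finset.card_univ, ZMod.card, nsmul_eq_mul,
    mul_div_cancel₀ _ hq]
  linarith [sum_abs_residueMass_sub_le hgs q]

/-- The image of A modulo q is a test set with nearly full mass under P and nearly none under the
uniform measure. -/
lemma abs_half_distUniform_sub_one_le {P : PMF ℤ}
    (hP : (fun k => (P k).toReal).HasFiniteSupport) (q : ℕ) [NeZero q] (A : Finset ℤ) {ε : ℝ}
    (hA : 1 - ε / 2 ≤ ∑ k ∈ A, (P k).toReal) (hcard : (A.card : ℝ) ≤ ε / 2 * q) :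
    |1 / 2 * distUniform P q - 1| ≤ ε := by
  classical
  have hq : (0 : ℝ) < q := by exact_mod_cast Nat.pos_of_ne_zero (NeZero.ne q)
  have hP1 : ∑' k, (P k).toReal = 1 := by
    rw [← ENNReal.tsum_toReal_eq fun k => PMF.apply_ne_top _ _, PMF.tsum_coe, ENNReal.toReal_one]
  set R : ZMod q → ℝ := residueMass (fun k => (P k).toReal) q with hR
  have hR0 : ∀ x, 0 ≤ R x := residueMass_nonneg (g := fun k => (P k).toReal) (fun _ => ENNReal.toReal_nonneg) q
  have hR1 : ∑ x, R x = 1 := by rw [hR, sum_residueMass hP, hP1]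
  have hc : ∑ _x : ZMod q, 1 / (q : ℝ) = 1 := by
    rw [Finset.sum_const, Finset.card_univ, ZMod.card, nsmul_eq_mul]
    field_simp
  rw [distUniform_eq_sum]
  have hup : ∑ x, |R x - 1 / (q : ℝ)| ≤ 2 := by
    calc ∑ x, |R x - 1 / (q : ℝ)| ≤ ∑ x, (R x + 1 / (q : ℝ)) := by
          refine Finset.sum_le_sum fun x _ => ?_
          have h1 := hR0 x
          have h2 : 0 ≤ 1 / (q : ℝ) := by positivity
          rw [abs_le]
          constructor <;> linarith
      _ = 2 := by rw [Finset.sum_add_distrib, hR1, hc]; norm_num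
  set B : Finset (ZMod q) := A.image fun k : ℤ => (k : ZMod q) with hB
  have hBcard : (B.card : ℝ) ≤ ε / 2 * q :=
    le_trans (by exact_mod_cast Finset.card_image_le) hcard
  have hBmass : 1 - ε / 2 ≤ ∑ x ∈ B, R x := by
    refine hA.trans ?_
    have h1 : ∑ k ∈ A, (P k).toReal = ∑ x ∈ B, ∑ k ∈ A.filter fun k : ℤ => (k : ZMod q) = x, (P k).toReal :=
      (Finset.sum_fiberwise_of_maps_to
        (fun k hk => Finset.mem_image_of_mem (fun k : ℤ => (k : ZMod q)) hk) _).symm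
    rw [h1]
    refine Finset.sum_le_sum fun x _ => ?_
    rw [Finset.sum_filter]
    refine Summable.sum_le_tsum A (fun k _ => ?_) ?_
    · split_ifs
      exacts [ENNReal.toReal_nonneg, le_rfl]
    · exact summable_of_hasFiniteSupport (HasFiniteSupport.of_eq_zero hP fun k hk => by simp [hk])
  have hlow : 2 * ∑ x ∈ B, (R x - 1 / (q : ℝ)) ≤ ∑ x, |R x - 1 / (q : ℝ)| := by
    have h0 : ∑ x, (R x - 1 / (q : ℝ)) = 0 := by rw [Finset.sum_sub_distrib, hR1, hc, sub_self]
    rw [← Finset.sum_add_sum_compl B] at h0 ⊢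
    have h1 : ∑ x ∈ B, (R x - 1 / (q : ℝ)) ≤ ∑ x ∈ B, |R x - 1 / (q : ℝ)| :=
      Finset.sum_le_sum fun x _ => le_abs_self _
    have h2 : -∑ x ∈ Bᶜ, (R x - 1 / (q : ℝ)) ≤ ∑ x ∈ Bᶜ, |R x - 1 / (q : ℝ)| := by
      rw [← Finset.sum_neg_distrib]
      exact Finset.sum_le_sum fun x _ => neg_le_abs _
    linarith
  rw [Finset.sum_sub_distrib, Finset.sum_const, nsmul_eq_mul, mul_one_div] at hlow
  have h3 : (B.card : ℝ) / q ≤ ε / 2 := by rwa [div_le_iff₀ hq]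
  rw [abs_le]
  constructor <;> linarith

/-- Nontrivial frequencies modulo `q` are reduced fractions whose denominators divide `q`. -/
lemma modEnergy_le_sum_divisors (g : ℤ → ℝ) {q : ℕ} (hq : 0 < q) :
    modEnergy g q ≤ ∑ d ∈ q.divisors.erase 1, fareyEnergy g d := by
  classical
  simp only [fareyEnergy]
  rw [Finset.sum_sigma']
  -- Reduction of r/q to lowest terms, recorded as (denominator, numerator).
  set φ : ℕ → Σ _ : ℕ, ℕ := fun r => ⟨q / Nat.gcd r q, r / Nat.gcd r q⟩ with hφ
  have hval : ∀ r ∈ (Finset.range q).erase 0,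
      ‖fourierZ g ((r : ℝ) / q)‖ ^ 2 = ‖fourierZ g (((φ r).2 : ℝ) / (φ r).1)‖ ^ 2 := by
    intro r _
    have hgpos : (Nat.gcd r q : ℝ) ≠ 0 := by
      exact_mod_cast (Nat.gcd_pos_of_pos_right r hq).ne'
    simp only [hφ]
    rw [Nat.cast_div (Nat.gcd_dvd_left r q) hgpos, Nat.cast_div (Nat.gcd_dvd_right r q) hgpos,
      div_div_div_cancel_right₀ hgpos]
  have hinj : Set.InjOn φ ((Finset.range q).erase 0 : Finset ℕ) := by
    intro r hr r' hr' he
    simp only [hφ, Sigma.mk.injEq, heq_eq_eq] at he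
    have e1 := Nat.div_mul_cancel (Nat.gcd_dvd_right r q)
    have e2 := Nat.div_mul_cancel (Nat.gcd_dvd_right r' q)
    have e3 := Nat.div_mul_cancel (Nat.gcd_dvd_left r q)
    have e4 := Nat.div_mul_cancel (Nat.gcd_dvd_left r' q)
    have hpos : 0 < q / Nat.gcd r q :=
      Nat.div_pos (Nat.le_of_dvd hq (Nat.gcd_dvd_right r q)) (Nat.gcd_pos_of_pos_right r hq)
    have hgg : Nat.gcd r q = Nat.gcd r' q := by
      apply Nat.eq_of_mul_eq_mul_left hpos
      rw [e1, he.1, e2]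
    rw [← e3, ← e4, he.2, hgg]
  rw [modEnergy, Finset.sum_congr rfl hval,
    ← Finset.sum_image (f := fun i : Σ _ : ℕ, ℕ => ‖fourierZ g ((i.2 : ℝ) / i.1)‖ ^ 2) hinj]
  refine Finset.sum_le_sum_of_subset_of_nonneg ?_ fun i _ _ => by positivity
  intro i hi
  obtain ⟨r, hr, rfl⟩ := Finset.mem_image.1 hi
  rw [Finset.mem_erase, Finset.mem_range] at hr
  have hgpos := Nat.gcd_pos_of_pos_right r hq
  have hglt : Nat.gcd r q < q :=
    (Nat.le_of_dvd (Nat.pos_of_ne_zero hr.1) (Nat.gcd_dvd_left r q)).trans_lt hr.2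
  simp only [hφ, Finset.mem_sigma, Finset.mem_erase, Nat.mem_divisors, reducedNumerators,
    Finset.mem_filter, Finset.mem_range]
  refine ⟨⟨?_, Nat.div_dvd_of_dvd (Nat.gcd_dvd_right r q), hq.ne'⟩, ?_,
    Nat.coprime_div_gcd_div_gcd hgpos⟩
  · intro h1
    have e1 := Nat.div_mul_cancel (Nat.gcd_dvd_right r q)
    rw [h1, one_mul] at e1
    omega
  · exact Nat.div_lt_div_of_lt_of_dvd (Nat.gcd_dvd_right r q) hr.2

/-! ### Non-mixing before time log q / H -/

namespace IsDigitWalk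

variable {a L : ℕ} {S : Finset ℤ} {w : ℤ → ℝ} {p : ℕ → ℤ → ℝ}

lemma card_le_of_le_mass (h : IsDigitWalk a L S w p) (m : ℕ) (A : Finset ℤ) {c : ℝ} (hc : 0 < c)
    (hA : ∀ x ∈ A, c ≤ p m x) : (A.card : ℝ) ≤ c⁻¹ := by
  rw [← one_div, le_div_iff₀ hc]
  calc (A.card : ℝ) * c = ∑ _x ∈ A, c := by rw [Finset.sum_const, nsmul_eq_mul]
    _ ≤ ∑ x ∈ A, p m x := Finset.sum_le_sum hA
    _ ≤ 1 := by
      rw [← h.tsum_eq m]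
      exact (h.summable m).sum_le_tsum _ fun x _ => h.nonneg m x

lemma one_sub_massOn_not_le (h : IsDigitWalk a L S w p) (m : ℕ) {P : ℤ → Prop} {A : Finset ℤ}
    (hA : ∀ x, p m x ≠ 0 → ¬ P x → x ∈ A) : 1 - massOn (p m) P ≤ ∑ x ∈ A, p m x := by
  classical
  have h1 : ∑' x, p m x ≤ ∑' x, ((if P x then p m x else 0) + if x ∈ A then p m x else 0) := by
    refine Summable.tsum_le_tsum (fun x => ?_) (h.summable m) ?_
    · by_cases hx : P x
      · rw [if_pos hx]
        split_ifs <;> linarith [h.nonneg m x]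
      · by_cases h0 : p m x = 0
        · simp [h0]
        · rw [if_neg hx, if_pos (hA x h0 hx), zero_add]
    · exact summable_of_hasFiniteSupport
        (HasFiniteSupport.of_eq_zero (h.hasFiniteSupport m) fun x hx => by simp [hx])
  rw [Summable.tsum_add, h.tsum_eq] at h1
  · have h2 : ∑' x, (if x ∈ A then p m x else 0) = ∑ x ∈ A, p m x := by
      rw [tsum_eq_sum (s := A) fun x hx => if_neg hx]
      exact Finset.sum_congr rfl fun x hx => if_pos hx
    rw [h2] at h1
    rw [massOn]
    linarith
  · exact summable_of_hasFiniteSupport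
      (HasFiniteSupport.of_eq_zero (h.hasFiniteSupport m) fun x hx => by simp [hx])
  · exact summable_of_hasFiniteSupport
      (HasFiniteSupport.of_eq_zero (h.hasFiniteSupport m) fun x hx => by simp [hx])

/-- Before time `log q / H` the walk is concentrated on a small subset of `ℤ/qℤ`. -/
theorem eventually_abs_half_distUniform_sub_one_le {P : ℕ → PMF ℤ}
    (h : IsDigitWalk a L S w fun m x => (P m x).toReal) {H : ℝ}
    (hH : HasEntropyRate (fun m x => (P m x).toReal) H) (hHpos : 0 < H) {δ : ℝ} (hδ : 0 < δ)
    {ε : ℝ} (hε : 0 < ε) :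
    ∀ᶠ q : ℕ in atTop, ∀ n : ℕ, H * n ≤ (1 - δ) * Real.log q →
      |1 / 2 * distUniform (P n) q - 1| ≤ ε := by
  obtain ⟨A, ρ, hA, hρ0, hρ1, htail⟩ := h.exists_massOn_small_le hH (ε := H * (δ / 2)) (by positivity)
  have hlim : Tendsto (fun n : ℕ => A * ρ ^ n) atTop (𝓝 0) := by
    simpa using (tendsto_pow_atTop_nhds_zero_of_lt_one hρ0.le hρ1).const_mul A
  obtain ⟨n₀, hn₀⟩ := eventually_atTop.1 (hlim.eventually_le_const (by positivity : 0 < ε / 2))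
  have hq1 : ∀ᶠ q : ℕ in atTop, ((2 * (L * a ^ n₀) + 1 : ℕ) : ℝ) ≤ ε / 2 * q :=
    (tendsto_natCast_atTop_atTop.const_mul_atTop (by positivity : 0 < ε / 2)).eventually_ge_atTop _
  have hq2 : ∀ᶠ q : ℕ in atTop, ((q : ℝ)) ^ (-(δ / 2)) ≤ ε / 2 :=
    ((tendsto_rpow_neg_atTop (by positivity : 0 < δ / 2)).comp
      tendsto_natCast_atTop_atTop).eventually_le_const (by positivity)
  filter_upwards [hq1, hq2, eventually_gt_atTop 0] with q hq1 hq2 hq0 n hn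
  have : NeZero q := ⟨hq0.ne'⟩
  have hq0' : (0 : ℝ) < q := by exact_mod_cast hq0
  have hfs := h.hasFiniteSupport n
  -- For n < n₀ the tail bound says nothing useful, but the support lies in a fixed bounded
  -- interval, negligible against q.
  rcases lt_or_ge n n₀ with hlt | hge
  · refine abs_half_distUniform_sub_one_le hfs q
      (Finset.Icc (-(L * a ^ n : ℕ) : ℤ) (L * a ^ n : ℕ)) ?_ ?_
    · have h1 := h.one_sub_massOn_not_le n (P := fun _ => False)
        (A := Finset.Icc (-(L * a ^ n : ℕ) : ℤ) (L * a ^ n : ℕ)) (fun x hx _ => by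
          rw [Finset.mem_Icc]
          exact_mod_cast _root_.abs_le.1 (h.abs_le_of_ne_zero hx))
      have h2 : massOn (fun x => (P n x).toReal) (fun _ => False) = 0 := by simp [massOn]
      rw [h2] at h1
      linarith
    · refine le_trans ?_ hq1
      rw [Int.card_Icc]
      have : a ^ n ≤ a ^ n₀ := Nat.pow_le_pow_right (by have := h.one_lt; omega) hlt.le
      have h3 : L * a ^ n ≤ L * a ^ n₀ := Nat.mul_le_mul_left L this
      exact_mod_cast (by omega : ((L * a ^ n : ℕ) + 1 - -((L * a ^ n : ℕ) : ℤ)).toNat ≤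
        2 * (L * a ^ n₀) + 1)
  · set c : ℝ := Real.exp (-((H + H * (δ / 2)) * n)) with hc
    have hc0 : 0 < c := Real.exp_pos _
    set B : Finset ℤ := (supportFinset hfs).filter fun x => c ≤ (P n x).toReal with hB
    refine abs_half_distUniform_sub_one_le hfs q B ?_ ?_
    · have h1 := h.one_sub_massOn_not_le n (P := fun x => (P n x).toReal < c) (A := B)
        (fun x hx hP => Finset.mem_filter.2 ⟨mem_supportFinset.2 hx, not_lt.1 hP⟩)
      have h2 := (htail n).trans (hn₀ n hge)
      linarith
    · refine (h.card_le_of_le_mass n B hc0 fun x hx => (Finset.mem_filter.1 hx).2).trans ?_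
      rw [hc, ← Real.exp_neg, neg_neg]
      -- Uses (1 + δ/2)(1 - δ) ≤ 1 - δ/2, so the typical set has at most q^(1-δ/2) points.
      have h1 : (H + H * (δ / 2)) * n ≤ (1 - δ / 2) * Real.log q := by
        have hlog : 0 ≤ Real.log q := Real.log_natCast_nonneg q
        have : (1 + δ / 2) * (H * n) ≤ (1 + δ / 2) * ((1 - δ) * Real.log q) := by gcongr
        nlinarith [sq_nonneg δ, mul_nonneg (sq_nonneg δ) hlog]
      calc Real.exp ((H + H * (δ / 2)) * n) ≤ Real.exp ((1 - δ / 2) * Real.log q) :=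
            Real.exp_le_exp.2 h1
        _ = (q : ℝ) ^ (1 + -(δ / 2)) := by
            rw [Real.rpow_def_of_pos hq0']
            congr 1
            ring
        _ = q * (q : ℝ) ^ (-(δ / 2)) := by rw [Real.rpow_add hq0', Real.rpow_one]
        _ ≤ q * (ε / 2) := by gcongr
        _ = ε / 2 * q := mul_comm _ _

end IsDigitWalk
-- Averaging over moduli and counting them
lemma sum_div_Ioc_le {T : ℕ → ℝ} (hT : ∀ d, 0 ≤ T d) {D₀ Q : ℕ} (h0 : 0 < D₀) (hQ : D₀ ≤ Q) :
    ∑ d ∈ Finset.Ioc D₀ Q, T d / d ≤ (∑ d ∈ Finset.Icc 1 Q, T d) / Q +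
      ∑ k ∈ Finset.Ico D₀ Q, (∑ d ∈ Finset.Icc 1 k, T d) / (k * (k + 1)) := by
  induction Q, hQ using Nat.le_induction with
  | base =>
    simp only [Finset.Ioc_self, Finset.sum_empty, Finset.Ico_self, add_zero]
    exact div_nonneg (Finset.sum_nonneg fun d _ => hT d) (Nat.cast_nonneg _)
  | succ Q hQ ih =>
    have hQ0 : (0 : ℝ) < Q := by exact_mod_cast h0.trans_le hQ
    rw [Finset.sum_Ioc_succ_top hQ, Finset.sum_Ico_succ_top hQ,
      Finset.sum_Icc_succ_top (by omega : 1 ≤ Q + 1)]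
    set s := ∑ d ∈ Finset.Icc 1 Q, T d with hs
    have h1 : s / (Q : ℝ) = s / (Q + 1) + s / (Q * (Q + 1)) := by
      field_simp
    push_cast
    rw [add_div]
    linarith

lemma sum_div_Ioc_le_of_le_rpow {T : ℕ → ℝ} (hT : ∀ d, 0 ≤ T d) {D₀ Q : ℕ} (h0 : 0 < D₀)
    (hQ : D₀ ≤ Q) {C c : ℝ} (hC : 0 ≤ C)
    (hS : ∀ D, D₀ ≤ D → D ≤ Q → ∑ d ∈ Finset.Icc 1 D, T d ≤ C * (D : ℝ) ^ (1 - c)) :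
    ∑ d ∈ Finset.Ioc D₀ Q, T d / d ≤
      C * ((Q : ℝ) ^ (-c) + ∑ k ∈ Finset.Ico D₀ Q, (k : ℝ) ^ (-(1 + c))) := by
  refine (sum_div_Ioc_le hT h0 hQ).trans ?_
  rw [mul_add, Finset.mul_sum]
  refine add_le_add ?_ (Finset.sum_le_sum fun k hk => ?_)
  · have hQ0 : (0 : ℝ) < Q := by exact_mod_cast h0.trans_le hQ
    rw [div_le_iff₀ hQ0, mul_assoc, ← Real.rpow_add_one hQ0.ne', neg_add_eq_sub]
    exact hS Q hQ le_rfl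
  · rw [Finset.mem_Ico] at hk
    have hk0 : (0 : ℝ) < k := by exact_mod_cast h0.trans_le hk.1
    rw [div_le_iff₀ (by positivity)]
    refine (hS k hk.1 hk.2.le).trans ?_
    have h1 : (k : ℝ) ^ (1 - c) = (k : ℝ) ^ (-(1 + c)) * (k * k) := by
      rw [← sq, ← Real.rpow_two, ← Real.rpow_add hk0]
      congr 1
      ring
    rw [h1, mul_assoc]
    gcongr
    linarith

lemma exists_forall_rpow_tail_le {c τ : ℝ} (hc : 0 < c) (hτ : 0 < τ) :
    ∃ D₁ : ℕ, ∀ D₀ Q : ℕ, D₁ ≤ D₀ → D₀ ≤ Q →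
      (Q : ℝ) ^ (-c) + ∑ k ∈ Finset.Ico D₀ Q, (k : ℝ) ^ (-(1 + c)) ≤ τ := by
  have hs : Summable fun k : ℕ => (k : ℝ) ^ (-(1 + c)) :=
    Real.summable_nat_rpow.2 (by linarith)
  have h1 : ∀ᶠ Q : ℕ in atTop, (Q : ℝ) ^ (-c) ≤ τ / 2 :=
    ((tendsto_rpow_neg_atTop hc).comp tendsto_natCast_atTop_atTop).eventually_le_const
      (by positivity)
  have h2 : ∀ᶠ D : ℕ in atTop, ∑' k : ℕ, (k : ℝ) ^ (-(1 + c)) - τ / 2 <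
      ∑ k ∈ Finset.range D, (k : ℝ) ^ (-(1 + c)) :=
    hs.hasSum.tendsto_sum_nat.eventually_const_lt (by linarith)
  obtain ⟨D₁, hD₁⟩ := eventually_atTop.1 (h1.and h2)
  refine ⟨D₁, fun D₀ Q hD hQ => ?_⟩
  have h3 := (hD₁ Q (hD.trans hQ)).1
  have h4 := (hD₁ D₀ hD).2
  have h5 : ∑ k ∈ Finset.range Q, (k : ℝ) ^ (-(1 + c)) ≤ ∑' k : ℕ, (k : ℝ) ^ (-(1 + c)) :=
    hs.sum_le_tsum _ fun k _ => by positivity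
  rw [Finset.sum_Ico_eq_sub _ hQ]
  linarith

/-- Markov's inequality for the counting measure on T, with e bounded below at the exceptional
moduli. -/
lemma proportion_ge_of_sum_le {A : Set ℕ} (T : Finset ℕ) (hT : A = T) (P : ℕ → Prop) (e : ℕ → ℝ)
    (he : ∀ q, 0 ≤ e q) {τ η : ℝ} (hτ : 0 < τ) (hbad : ∀ q ∈ T, ¬ P q → τ ≤ e q)
    (hsum : ∑ q ∈ T, e q ≤ τ * (η * T.card)) :
    (1 - η) * (A.ncard : ℝ) ≤ (({q ∈ A | P q}).ncard : ℝ) := by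
  classical
  have h1 : ({q ∈ A | P q} : Set ℕ) = (T.filter P : Finset ℕ) := by
    ext q
    simp [hT]
  rw [h1, hT, Set.ncard_coe_finset, Set.ncard_coe_finset]
  have h2 : ((T.filter P).card : ℝ) + (T.filter fun q => ¬ P q).card = T.card := by
    exact_mod_cast Finset.card_filter_add_card_filter_not P
  have h3 : τ * ((T.filter fun q => ¬ P q).card : ℝ) ≤ τ * (η * T.card) := by
    refine le_trans ?_ hsum
    calc τ * ((T.filter fun q => ¬ P q).card : ℝ) = ∑ _q ∈ T.filter fun q => ¬ P q, τ := by
          rw [Finset.sum_const, nsmul_eq_mul, mul_comm]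
      _ ≤ ∑ q ∈ T.filter fun q => ¬ P q, e q :=
          Finset.sum_le_sum fun q hq => hbad q (Finset.mem_filter.1 hq).1 (Finset.mem_filter.1 hq).2
      _ ≤ ∑ q ∈ T, e q :=
          Finset.sum_le_sum_of_subset_of_nonneg (Finset.filter_subset _ _) fun q _ _ => he q
  have h4 := le_of_mul_le_mul_left h3 hτ
  linarith

/-- Interchange the sums: at most Q/d elements of T are multiples of d, and divisors inherit
coprimality to a. -/
lemma sum_divisors_le {F : ℕ → ℝ} (hF : ∀ d, 0 ≤ F d) (Q a : ℕ) (T : Finset ℕ)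
    (hT : ∀ q ∈ T, 0 < q ∧ q ≤ Q ∧ q.Coprime a) :
    ∑ q ∈ T, ∑ d ∈ q.divisors.erase 1, F d ≤
      Q * ∑ d ∈ Finset.Ioc 1 Q with d.Coprime a, F d / d := by
  classical
  set R := (Finset.Ioc 1 Q).filter fun d => d.Coprime a with hR
  have h1 : ∀ q ∈ T, ∑ d ∈ q.divisors.erase 1, F d ≤ ∑ d ∈ R, if d ∣ q then F d else 0 := by
    intro q hq
    obtain ⟨hq0, hqQ, hqa⟩ := hT q hq
    rw [← Finset.sum_filter]
    refine Finset.sum_le_sum_of_subset_of_nonneg ?_ fun d _ _ => hF d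
    intro d hd
    rw [Finset.mem_erase, Nat.mem_divisors] at hd
    have hd0 : d ≠ 0 := fun h0 => hq0.ne' (Nat.eq_zero_of_zero_dvd (h0 ▸ hd.2.1))
    have hdq := Nat.le_of_dvd hq0 hd.2.1
    simp only [hR, Finset.mem_filter, Finset.mem_Ioc]
    exact ⟨⟨⟨by omega, by omega⟩, hqa.coprime_dvd_left hd.2.1⟩, hd.2.1⟩
  refine (Finset.sum_le_sum h1).trans ?_
  rw [Finset.sum_comm, Finset.mul_sum]
  refine Finset.sum_le_sum fun d hd => ?_
  rw [← Finset.sum_filter, Finset.sum_const, nsmul_eq_mul, mul_div_left_comm, mul_comm]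
  refine mul_le_mul_of_nonneg_left ?_ (hF d)
  have h2 : (T.filter fun q => d ∣ q) ⊆ (Finset.Ioc 0 Q).filter fun q => d ∣ q := by
    intro q hq
    rw [Finset.mem_filter] at hq
    obtain ⟨hq0, hqQ, _⟩ := hT q hq.1
    exact Finset.mem_filter.2 ⟨Finset.mem_Ioc.2 ⟨hq0, hqQ⟩, hq.2⟩
  have h3 := Finset.card_le_card h2
  rw [Nat.Ioc_filter_dvd_card_eq_div] at h3
  exact le_trans (by exact_mod_cast h3) Nat.cast_div_le

/-- The products (a+1)(1+ka) with 1 ≤ k ≤ Q/(4a²) are composite, coprime to a and at most Q.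
Rounding down the number of k loses at most a factor 2. -/
lemma card_coprime_composites_ge {a : ℕ} (ha : 1 < a) {Q : ℕ} (hQ : 4 * a ^ 2 ≤ Q) :
    (Q : ℝ) / (8 * a ^ 2) ≤
      (((Finset.Icc 1 Q).filter fun q => 1 < q ∧ ¬ q.Prime ∧ q.Coprime a).card : ℝ) := by
  classical
  set M := Q / (4 * a ^ 2) with hM
  have hM1 : 1 ≤ M := Nat.div_pos hQ (by positivity)
  have hMQ : 4 * a ^ 2 * M ≤ Q := Nat.mul_div_le Q _
  have hsub : (Finset.Icc 1 M).image (fun k => (a + 1) * (1 + k * a)) ⊆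
      (Finset.Icc 1 Q).filter fun q => 1 < q ∧ ¬ q.Prime ∧ q.Coprime a := by
    intro q hq
    obtain ⟨k, hk, rfl⟩ := Finset.mem_image.1 hq
    rw [Finset.mem_Icc] at hk
    have hka : 1 ≤ k * a := Nat.mul_pos (by omega) (by omega)
    have hle : (a + 1) * (1 + k * a) ≤ Q := by
      refine le_trans ?_ hMQ
      calc (a + 1) * (1 + k * a) ≤ (2 * a) * (2 * (M * a)) := by
            refine Nat.mul_le_mul (by omega) ?_
            have : k * a ≤ M * a := Nat.mul_le_mul_right a hk.2
            omega
        _ = 4 * a ^ 2 * M := by ring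
    have hgt : 1 < (a + 1) * (1 + k * a) := by nlinarith
    refine Finset.mem_filter.2 ⟨Finset.mem_Icc.2 ⟨hgt.le, hle⟩, hgt, ?_, ?_⟩
    · exact Nat.not_prime_mul (by omega) (by omega)
    · refine Nat.Coprime.mul_left ?_ ?_
      · simp
      · simp
  have hinj : Set.InjOn (fun k => (a + 1) * (1 + k * a)) (Finset.Icc 1 M : Finset ℕ) := by
    intro k _ k' _ he
    have h1 : 1 + k * a = 1 + k' * a := Nat.eq_of_mul_eq_mul_left (by omega) he
    exact Nat.eq_of_mul_eq_mul_right (by omega : 0 < a) (by omega)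
  have hcard := Finset.card_le_card hsub
  rw [Finset.card_image_of_injOn hinj, Nat.card_Icc, Nat.add_sub_cancel] at hcard
  refine le_trans ?_ (by exact_mod_cast hcard : (M : ℝ) ≤ _)
  have hlt : Q < 4 * a ^ 2 * (M + 1) := Nat.lt_mul_div_succ Q (by positivity)
  have hlt' : (Q : ℝ) < 4 * a ^ 2 * (M + 1) := by exact_mod_cast hlt
  have hM1' : (1 : ℝ) ≤ M := by exact_mod_cast hM1
  have ha' : (0 : ℝ) < a := by exact_mod_cast (by omega : 0 < a)
  rw [div_le_iff₀ (by positivity)]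
  nlinarith [sq_nonneg (a : ℝ), mul_le_mul_of_nonneg_left hM1' (by positivity : (0 : ℝ) ≤ a ^ 2)]

lemma eventually_rpow_le_primeCounting {c C η : ℝ} (hc : 0 < c) (hC : 0 ≤ C) (hη : 0 < η) :
    ∀ᶠ Q : ℕ in atTop, C * (Q : ℝ) ^ (1 - c) ≤ η * (Nat.primeCounting Q : ℝ) := by
  have h1 : ∀ᶠ Q : ℕ in atTop, 2 * (C + 1) / η * Real.log Q ≤ (Q : ℝ) ^ c := by
    have h := ((isLittleO_log_rpow_atTop hc).bound
      (by positivity : 0 < (2 * (C + 1) / η)⁻¹))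
    filter_upwards [tendsto_natCast_atTop_atTop.eventually h] with Q hQ
    rw [Real.norm_of_nonneg (Real.log_natCast_nonneg Q),
      Real.norm_of_nonneg (by positivity), ← div_eq_inv_mul, le_div_iff₀ (by positivity)] at hQ
    rwa [mul_comm]
  have h2 : ∀ᶠ Q : ℕ in atTop, Real.log ((Q : ℝ) + 1) ≤ (Q : ℝ) / 10 := by
    have h := (Real.isLittleO_log_id_atTop.bound (by norm_num : (0 : ℝ) < 1 / 20))
    have h' := (tendsto_natCast_atTop_atTop (R := ℝ)).comp (tendsto_add_atTop_nat 1)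
    filter_upwards [h'.eventually h, eventually_ge_atTop 1] with Q hQ hQ1
    simp only [Function.comp, id, Nat.cast_add, Nat.cast_one] at hQ
    have hQ1' : (1 : ℝ) ≤ Q := by exact_mod_cast hQ1
    rw [Real.norm_of_nonneg (Real.log_nonneg (by linarith)),
      Real.norm_of_nonneg (by positivity)] at hQ
    linarith
  filter_upwards [h1, h2, eventually_ge_atTop 2] with Q h1 h2 hQ
  have hQ' : (2 : ℝ) ≤ Q := by exact_mod_cast hQ
  have hQ0 : (0 : ℝ) < Q := by linarith
  have hlog : 0 < Real.log Q := Real.log_pos (by linarith)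
  have h3 := Chebyshev.pi_ge Q
  rw [div_le_iff₀ hlog] at h3
  have h4 : (Q : ℝ) / 2 ≤ Nat.primeCounting Q * Real.log Q := by
    have := Real.log_two_gt_d9
    nlinarith
  refine le_of_mul_le_mul_right ?_ hlog
  have h5 : C * (2 * Real.log Q) ≤ η * (Q : ℝ) ^ c := by
    have h6 := mul_le_mul_of_nonneg_left h1 hη.le
    have h7 : η * (2 * (C + 1) / η * Real.log Q) = (C + 1) * (2 * Real.log Q) := by
      field_simp
    nlinarith
  have h8 : (Q : ℝ) ^ (1 - c) * (Q : ℝ) ^ c = Q := by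
    rw [← Real.rpow_add hQ0]
    simp
  have h9 : 0 < (Q : ℝ) ^ (1 - c) := Real.rpow_pos_of_pos hQ0 _
  calc C * (Q : ℝ) ^ (1 - c) * Real.log Q
      = (Q : ℝ) ^ (1 - c) * (C * (2 * Real.log Q)) / 2 := by ring
    _ ≤ (Q : ℝ) ^ (1 - c) * (η * (Q : ℝ) ^ c) / 2 := by gcongr
    _ = η * ((Q : ℝ) ^ (1 - c) * (Q : ℝ) ^ c / 2) := by ring
    _ = η * ((Q : ℝ) / 2) := by rw [h8]
    _ ≤ η * (Nat.primeCounting Q * Real.log Q) := by gcongr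
    _ = η * Nat.primeCounting Q * Real.log Q := by ring

lemma log_natCast_le_iff {q : ℕ} (hq : 0 < q) (t : ℝ) : Real.log q ≤ t ↔ q ≤ ⌊Real.exp t⌋₊ := by
  rw [Nat.le_floor_iff (Real.exp_pos t).le, Real.log_le_iff_le_exp (by exact_mod_cast hq)]

lemma primesUpTo_eq (t : ℝ) :
    primesUpTo t = ((Finset.Icc 1 ⌊Real.exp t⌋₊).filter Nat.Prime : Finset ℕ) := by
  ext q
  simp only [primesUpTo, Set.mem_ofPred_eq, Finset.coe_filter, Finset.mem_Icc]
  constructor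
  · rintro ⟨hq, hlog⟩
    exact ⟨⟨hq.pos, (log_natCast_le_iff hq.pos t).1 hlog⟩, hq⟩
  · rintro ⟨⟨_, hlog⟩, hq⟩
    exact ⟨hq, (log_natCast_le_iff hq.pos t).2 hlog⟩

lemma coprimeCompositesUpTo_eq (a : ℕ) (t : ℝ) :
    coprimeCompositesUpTo a t = ((Finset.Icc 1 ⌊Real.exp t⌋₊).filter
      fun q => 1 < q ∧ ¬ q.Prime ∧ q.Coprime a : Finset ℕ) := by
  ext q
  simp only [coprimeCompositesUpTo, Set.mem_ofPred_eq, Finset.coe_filter, Finset.mem_Icc]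
  constructor
  · rintro ⟨h1, h2, h3, hlog⟩
    exact ⟨⟨h1.le, (log_natCast_le_iff (by omega) t).1 hlog⟩, h1, h2, h3⟩
  · rintro ⟨⟨_, hlog⟩, h1, h2, h3⟩
    exact ⟨h1, h2, h3, (log_natCast_le_iff (by omega) t).2 hlog⟩

lemma primesUpTo_eq_empty {t : ℝ} (ht : t ≤ 0) : primesUpTo t = ∅ := by
  refine Set.eq_empty_of_forall_notMem fun q ⟨hq, hlog⟩ => ?_
  have := Real.log_pos (by exact_mod_cast hq.one_lt : (1 : ℝ) < q)
  linarith

lemma coprimeCompositesUpTo_eq_empty (a : ℕ) {t : ℝ} (ht : t ≤ 0) :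
    coprimeCompositesUpTo a t = ∅ := by
  refine Set.eq_empty_of_forall_notMem fun q ⟨hq, _, _, hlog⟩ => ?_
  have := Real.log_pos (by exact_mod_cast hq : (1 : ℝ) < q)
  linarith

lemma card_filter_prime_Icc (Q : ℕ) :
    ((Finset.Icc 1 Q).filter Nat.Prime).card = Nat.primeCounting Q := by
  rw [Nat.primeCounting, Nat.primeCounting', Nat.count_eq_card_filter_range]
  congr 1
  ext q
  simp only [Finset.mem_filter, Finset.mem_Icc, Finset.mem_range]
  constructor
  · rintro ⟨h1, h2⟩
    exact ⟨by omega, h2⟩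
  · rintro ⟨h1, h2⟩
    exact ⟨⟨h2.pos, by omega⟩, h2⟩

/-- E slightly below H and c small. With l = log a, the fourth condition is where H > (1/2) log a
enters; the last is the room left by δ. -/
lemma exists_exponents {H l δ : ℝ} (hl : 0 < l) (hH : 1 / 2 * l < H) (hδ : 0 < δ) (hδ1 : δ < 1) :
    ∃ E c : ℝ, 0 < E ∧ E < H ∧ 0 < c ∧ (1 + c) * l ≤ 2 * E ∧ (1 + c) * ((1 - δ) * H) < E := by
  have hH0 : 0 < H := by linarith
  set e := min ((H - 1 / 2 * l) / 2) (H * (δ / 4)) with he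
  have he1 : e ≤ (H - 1 / 2 * l) / 2 := min_le_left _ _
  have he2 : e ≤ H * (δ / 4) := min_le_right _ _
  have he0 : 0 < e := lt_min (by linarith) (by positivity)
  set c := min (δ / 4) (2 * (H - e) / l - 1) with hc
  have hc1 : c ≤ δ / 4 := min_le_left _ _
  have hc2 : c ≤ 2 * (H - e) / l - 1 := min_le_right _ _
  have hc0 : 0 < c := by
    refine lt_min (by positivity) ?_
    rw [sub_pos, lt_div_iff₀ hl]
    linarith
  refine ⟨H - e, c, by linarith, by linarith, hc0, ?_, ?_⟩
  · have : 1 + c ≤ 2 * (H - e) / l := by linarith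
    rwa [le_div_iff₀ hl] at this
  · have h1 : (1 + c) * ((1 - δ) * H) ≤ (1 + δ / 4) * ((1 - δ) * H) := by
      have : 0 ≤ (1 - δ) * H := mul_nonneg (by linarith) hH0.le
      gcongr
    nlinarith [mul_pos hH0 hδ, mul_pos hδ hδ, mul_pos hH0 (mul_pos hδ hδ)]

lemma massOn_mono {g : ℤ → ℝ} (hg : g.HasFiniteSupport) (hg0 : ∀ x, 0 ≤ g x) {P R : ℤ → Prop}
    (h : ∀ x, P x → R x) : massOn g P ≤ massOn g R := by
  classical
  rw [massOn, massOn]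
  refine Summable.tsum_le_tsum (fun x => ?_) ?_ ?_
  · by_cases hx : P x
    · rw [if_pos hx, if_pos (h x hx)]
    · rw [if_neg hx]
      split_ifs
      exacts [hg0 x, le_rfl]
  · exact summable_of_hasFiniteSupport (HasFiniteSupport.of_eq_zero hg fun x hx => by simp [hx])
  · exact summable_of_hasFiniteSupport (HasFiniteSupport.of_eq_zero hg fun x hx => by simp [hx])

/-! ### Mixing for most moduli -/

namespace IsDigitWalk

variable {a L : ℕ} {S : Finset ℤ} {w : ℤ → ℝ} {p : ℕ → ℤ → ℝ}

lemma exists_sum_massOn_atypical_le (h : IsDigitWalk a L S w p) {H E : ℝ}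
    (hH : HasEntropyRate p H) (hE : E < H) {ε : ℝ} (hε : 0 < ε) :
    ∃ m₀ : ℕ, 1 ≤ m₀ ∧ ∀ N n : ℕ,
      ∑ i ∈ Finset.range n, massOn (p (i + 1)) (atypical p E m₀ N (i + 1)) ≤ ε := by
  obtain ⟨A, ρ, hA, hρ0, hρ1, htail⟩ := h.exists_massOn_large_le hH (sub_pos.2 hE)
  rw [sub_sub_cancel] at htail
  -- Splits the decay ρ^m = σ^m σ^m: one factor gives the small σ^m₀, the other a convergent series.
  set σ := √ρ with hσ
  have hσ0 : 0 ≤ σ := Real.sqrt_nonneg ρ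
  have hσ1 : σ < 1 := by rw [hσ, Real.sqrt_lt' one_pos]; simpa using hρ1
  have hσρ : ρ = σ * σ := (Real.mul_self_sqrt hρ0.le).symm
  have hlim : Tendsto (fun m : ℕ => A * (1 - σ)⁻¹ * σ ^ m) atTop (𝓝 0) := by
    simpa using (tendsto_pow_atTop_nhds_zero_of_lt_one hσ0 hσ1).const_mul (A * (1 - σ)⁻¹)
  obtain ⟨m₀, hm₀, hm₀1⟩ := ((hlim.eventually_le_const hε).and (eventually_ge_atTop 1)).exists
  refine ⟨m₀, hm₀1, fun N n => le_trans ?_ hm₀⟩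
  have hpt : ∀ i ∈ Finset.range n,
      massOn (p (i + 1)) (atypical p E m₀ N (i + 1)) ≤ A * σ ^ m₀ * σ ^ i := by
    intro i _
    have hnn : 0 ≤ A * σ ^ m₀ * σ ^ i := by positivity
    by_cases hi : m₀ ≤ i + 1
    · refine (massOn_mono (h.hasFiniteSupport _) (h.nonneg _) fun x hx => hx.2.2).trans
        ((htail (i + 1)).trans ?_)
      rw [hσρ, mul_pow, mul_assoc]
      refine mul_le_mul_of_nonneg_left ?_ hA
      exact mul_le_mul (pow_le_pow_of_le_one hσ0 hσ1.le hi)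
        (pow_le_pow_of_le_one hσ0 hσ1.le (Nat.le_succ i)) (by positivity) (by positivity)
    · have h0 : massOn (p (i + 1)) (atypical p E m₀ N (i + 1)) = 0 := by
        simp [massOn, atypical, hi]
      rw [h0]
      exact hnn
  refine (Finset.sum_le_sum hpt).trans ?_
  rw [← Finset.mul_sum]
  have hgeo : ∑ i ∈ Finset.range n, σ ^ i ≤ (1 - σ)⁻¹ := by
    rw [← tsum_geometric_of_lt_one hσ0 hσ1]
    exact (summable_geometric_of_lt_one hσ0 hσ1).sum_le_tsum _ fun i _ => by positivity
  calc A * σ ^ m₀ * ∑ i ∈ Finset.range n, σ ^ i ≤ A * σ ^ m₀ * (1 - σ)⁻¹ := by gcongr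
    _ = A * (1 - σ)⁻¹ * σ ^ m₀ := by ring

/-- Most of the mass of the walk has small Fourier transform at most fractions with denominators up
to `exp ((1 - δ) * H * n)`. -/
theorem exists_submeasure (h : IsDigitWalk a L S w p) {H E c s : ℝ} (hH : HasEntropyRate p H)
    (hE0 : 0 < E) (hE : E < H) (hc0 : 0 < c) (hc : (1 + c) * Real.log a ≤ 2 * E)
    (hs : (1 + c) * s < E) {ε : ℝ} (hε : 0 < ε) :
    ∃ m₀ : ℕ, 1 ≤ m₀ ∧ ∀ K : ℕ, ∀ᶠ n : ℕ in atTop, ∃ g : ℤ → ℝ, (∀ x, 0 ≤ g x) ∧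
      (∀ x, g x ≤ p n x) ∧ 1 - ε ≤ ∑' x, g x ∧
      (∀ D : ℕ, a ^ m₀ ≤ D → Real.log D ≤ s * n →
        ∑ d ∈ Finset.Icc 1 D, fareyEnergy g d ≤ 9 * L * Real.exp E * (D : ℝ) ^ (1 - c)) ∧
      ∀ (κ : ℝ) (d : ℕ), 1 < d → d.Coprime a →
        (∀ t : ℤ, ¬ (d : ℤ) ∣ t → ‖stepFourier S w ((t : ℝ) / d)‖ ≤ κ) →
        fareyEnergy g d ≤ d * (κ ^ K) ^ 2 := by
  obtain ⟨m₀, hm₀, hmass⟩ := h.exists_sum_massOn_atypical_le hH hE hε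
  refine ⟨m₀, hm₀, fun K => ?_⟩
  -- Killing stops at N = n - K; this says (1+c)sn ≤ EN, so the large sieve bound loses nothing from
  -- the K free steps.
  have hlarge : ∀ᶠ n : ℕ in atTop, E * K ≤ (E - (1 + c) * s) * n :=
    (tendsto_natCast_atTop_atTop.const_mul_atTop (sub_pos.2 hs)).eventually_ge_atTop _
  filter_upwards [hlarge, eventually_ge_atTop (m₀ + K)] with n hn hnK
  obtain ⟨N, rfl⟩ : ∃ N, n = N + K := ⟨n - K, by omega⟩
  refine ⟨killedWalk a S w (atypical p E m₀ N) (N + K), h.killedWalk_nonneg _, h.killedWalk_le _,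
    ?_, ?_, ?_⟩
  · have h1 := h.tsum_killedWalk_ge (Bad := atypical p E m₀ N) (N + K)
    have h2 := hmass N (N + K)
    linarith
  · intro D hD hlog
    refine h.sum_fareyEnergy_killedWalk_le hE0 hc hm₀ (by omega) (by omega) hD ?_
    push_cast at hn hlog
    have : (1 + c) * Real.log D ≤ (1 + c) * (s * (N + K)) := by gcongr
    linarith
  · intro κ d hd hda hκ
    calc fareyEnergy (killedWalk a S w (atypical p E m₀ N) (N + K)) d
        ≤ ∑ _r ∈ reducedNumerators d, (κ ^ K) ^ 2 := by
          refine Finset.sum_le_sum fun r hr => pow_le_pow_left₀ (norm_nonneg _) ?_ 2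
          refine h.norm_fourierZ_killedWalk_le (fun m x hm hx => ?_) hκ hd hda
            (Finset.mem_filter.1 hr).2 K
          exact absurd hx.2.1 (not_le.2 hm)
      _ = (reducedNumerators d).card * (κ ^ K) ^ 2 := by rw [Finset.sum_const, nsmul_eq_mul]
      _ ≤ d * (κ ^ K) ^ 2 := by
          refine mul_le_mul_of_nonneg_right ?_ (by positivity)
          have : (reducedNumerators d).card ≤ d :=
            (Finset.card_filter_le _ _).trans_eq (Finset.card_range d)
          exact_mod_cast this

end IsDigitWalk

lemma tendsto_floor_exp_mul {s : ℝ} (hs : 0 < s) :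
    Tendsto (fun n : ℕ => ⌊Real.exp (s * n)⌋₊) atTop atTop :=
  tendsto_nat_floor_atTop.comp (Real.tendsto_exp_atTop.comp
    (tendsto_natCast_atTop_atTop.const_mul_atTop hs))

/-- The missing mass accounts for at most ε/2 of the distance, so the square root of the energy must
supply the other ε/2. -/
lemma le_modEnergy_of_lt_distUniform {P : PMF ℤ} (hP : (fun k => (P k).toReal).HasFiniteSupport)
    {g : ℤ → ℝ} (hg0 : ∀ k, 0 ≤ g k) (hg : ∀ k, g k ≤ (P k).toReal) {q : ℕ} (hq : 0 < q) {ε : ℝ}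
    (hε : 0 < ε) (hmass : 1 - ε / 4 ≤ ∑' k, g k) (hdist : ¬ distUniform P q ≤ ε) :
    ε ^ 2 / 4 ≤ modEnergy g q := by
  have : NeZero q := ⟨hq.ne'⟩
  have h1 := distUniform_le hP hg0 hg q
  have h2 : ε / 2 ≤ √(modEnergy g q) := by linarith
  have h3 := Real.sq_sqrt (modEnergy_nonneg g q)
  nlinarith

lemma modEnergy_prime_le (g : ℤ → ℝ) {q : ℕ} (hq : q.Prime) : modEnergy g q ≤ fareyEnergy g q := by
  refine (modEnergy_le_sum_divisors g hq.pos).trans_eq ?_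
  rw [hq.divisors, Finset.erase_insert (by simpa using hq.one_lt.ne), Finset.sum_singleton]

namespace IsDigitWalk

variable {a L : ℕ} {S : Finset ℤ} {w : ℤ → ℝ} {P : ℕ → PMF ℤ}

theorem eventually_proportion_primes (h : IsDigitWalk a L S w fun m x => (P m x).toReal)
    {H : ℝ} (hH : HasEntropyRate (fun m x => (P m x).toReal) H) (hHa : 1 / 2 * Real.log a < H)
    {δ : ℝ} (hδ : 0 < δ) {ε : ℝ} (hε : 0 < ε) {η : ℝ} (hη : 0 < η) :
    ∀ᶠ n : ℕ in atTop, (1 - η) * ((primesUpTo ((1 - δ) * H * n)).ncard : ℝ) ≤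
      (({q ∈ primesUpTo ((1 - δ) * H * n) | distUniform (P n) q ≤ ε}).ncard : ℝ) := by
  have hla : 0 < Real.log a := Real.log_pos (by exact_mod_cast h.one_lt)
  have hH0 : 0 < H := by linarith
  rcases le_or_gt 1 δ with hδ1 | hδ1
  · refine Eventually.of_forall fun n => ?_
    have : (1 - δ) * H * n ≤ 0 :=
      mul_nonpos_of_nonpos_of_nonneg (mul_nonpos_of_nonpos_of_nonneg (by linarith) hH0.le)
        (Nat.cast_nonneg n)
    rw [primesUpTo_eq_empty this]
    simp
  obtain ⟨E, c, hE0, hE, hc0, hc, hs⟩ := exists_exponents hla hHa hδ hδ1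
  obtain ⟨m₀, _, hm₀⟩ := h.exists_submeasure hH hE0 hE hc0 hc hs (by positivity : 0 < ε / 4)
  have hQ := tendsto_floor_exp_mul (mul_pos (sub_pos.2 hδ1) hH0)
  -- K = 0: a prime has no proper divisors d > 1 to treat, so no free steps are needed.
  filter_upwards [hm₀ 0, hQ.eventually_ge_atTop (a ^ m₀), hQ.eventually
    (eventually_rpow_le_primeCounting hc0 (by positivity : 0 ≤ 9 * L * Real.exp E)
      (by positivity : 0 < ε ^ 2 / 4 * η))] with n hn hQ1 hQ2
  obtain ⟨g, hg0, hg, hmass, hfarey, _⟩ := hn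
  set Q := ⌊Real.exp ((1 - δ) * H * n)⌋₊ with hQdef
  have hQpos : 0 < Q := lt_of_lt_of_le (Nat.pow_pos (by have := h.one_lt; omega)) hQ1
  refine proportion_ge_of_sum_le _ (primesUpTo_eq _) _ (modEnergy g) (modEnergy_nonneg g)
    (by positivity : 0 < ε ^ 2 / 4) (fun q hq hbad => ?_) ?_
  · exact le_modEnergy_of_lt_distUniform (h.hasFiniteSupport n) hg0 hg
      (Finset.mem_filter.1 hq).2.pos hε hmass hbad
  · rw [card_filter_prime_Icc, ← mul_assoc]
    refine le_trans ?_ ((hfarey Q hQ1 ((log_natCast_le_iff hQpos _).2 le_rfl)).trans hQ2)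
    calc ∑ q ∈ (Finset.Icc 1 Q).filter Nat.Prime, modEnergy g q
        ≤ ∑ q ∈ (Finset.Icc 1 Q).filter Nat.Prime, fareyEnergy g q :=
          Finset.sum_le_sum fun q hq => modEnergy_prime_le g (Finset.mem_filter.1 hq).2
      _ ≤ ∑ q ∈ Finset.Icc 1 Q, fareyEnergy g q :=
          Finset.sum_le_sum_of_subset_of_nonneg (Finset.filter_subset _ _)
            fun q _ _ => fareyEnergy_nonneg g q

theorem eventually_proportion_composites (h : IsDigitWalk a L S w fun m x => (P m x).toReal)
    (hgcd : ∀ d : ℕ, (∀ x ∈ S, ∀ y ∈ S, (d : ℤ) ∣ x - y) → d = 1)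
    {H : ℝ} (hH : HasEntropyRate (fun m x => (P m x).toReal) H) (hHa : 1 / 2 * Real.log a < H)
    {δ : ℝ} (hδ : 0 < δ) {ε : ℝ} (hε : 0 < ε) {η : ℝ} (hη : 0 < η) :
    ∀ᶠ n : ℕ in atTop, (1 - η) * ((coprimeCompositesUpTo a ((1 - δ) * H * n)).ncard : ℝ) ≤
      (({q ∈ coprimeCompositesUpTo a ((1 - δ) * H * n) |
        distUniform (P n) q ≤ ε}).ncard : ℝ) := by
  have hla : 0 < Real.log a := Real.log_pos (by exact_mod_cast h.one_lt)
  have hH0 : 0 < H := by linarith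
  rcases le_or_gt 1 δ with hδ1 | hδ1
  · refine Eventually.of_forall fun n => ?_
    have : (1 - δ) * H * n ≤ 0 :=
      mul_nonpos_of_nonpos_of_nonneg (mul_nonpos_of_nonpos_of_nonneg (by linarith) hH0.le)
        (Nat.cast_nonneg n)
    rw [coprimeCompositesUpTo_eq_empty a this]
    simp
  have ha0 : (0 : ℝ) < a := by exact_mod_cast (by have := h.one_lt; omega : 0 < a)
  obtain ⟨E, c, hE0, hE, hc0, hc, hs⟩ := exists_exponents hla hHa hδ hδ1
  obtain ⟨m₀, _, hm₀⟩ := h.exists_submeasure hH hE0 hE hc0 hc hs (by positivity : 0 < ε / 4)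
  set C : ℝ := 9 * L * Real.exp E with hC
  have hC0 : 0 ≤ C := by positivity
  -- Energy threshold ε²/4, times the allowed exceptional proportion η, times the density bound
  -- 1/(8a²) for the composites.
  set τ : ℝ := ε ^ 2 / 4 * η / (8 * a ^ 2) with hτ
  have hτ0 : 0 < τ := by positivity
  obtain ⟨D₁, hD₁⟩ := exists_forall_rpow_tail_le hc0
    (by positivity : 0 < τ / 2 / (C + 1))
  -- The order of choices matters: D₀ depends on m₀ but not on K, then κ on D₀, then K on both. This
  -- is why m₀ precedes K in `exists_submeasure`.
  set D₀ : ℕ := max D₁ (a ^ m₀) with hD₀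
  have hD₀pos : 0 < D₀ := lt_of_lt_of_le (Nat.pow_pos (by have := h.one_lt; omega))
    (le_max_right D₁ (a ^ m₀))
  obtain ⟨κ, hκ0, hκ1, hκ⟩ := h.exists_norm_stepFourier_le hgcd D₀
  obtain ⟨K, hK⟩ : ∃ K : ℕ, (D₀ : ℝ) * (κ ^ K) ^ 2 ≤ τ / 2 := by
    have hlim : Tendsto (fun K : ℕ => (D₀ : ℝ) * (κ ^ K) ^ 2) atTop (𝓝 0) := by
      simpa using ((tendsto_pow_atTop_nhds_zero_of_lt_one hκ0 hκ1).pow 2).const_mul (D₀ : ℝ)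
    exact (hlim.eventually_le_const (by positivity)).exists
  have hQ := tendsto_floor_exp_mul (mul_pos (sub_pos.2 hδ1) hH0)
  filter_upwards [hm₀ K, hQ.eventually_ge_atTop D₀, hQ.eventually_ge_atTop (4 * a ^ 2)]
    with n hn hQ1 hQ2
  obtain ⟨g, hg0, hg, hmass, hfarey, hsmall⟩ := hn
  set Q := ⌊Real.exp ((1 - δ) * H * n)⌋₊ with hQdef
  refine proportion_ge_of_sum_le _ (coprimeCompositesUpTo_eq a _) _ (modEnergy g)
    (modEnergy_nonneg g) (by positivity : 0 < ε ^ 2 / 4) (fun q hq hbad => ?_) ?_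
  · have hq1 := (Finset.mem_filter.1 hq).2.1
    exact le_modEnergy_of_lt_distUniform (h.hasFiniteSupport n) hg0 hg (by omega) hε hmass hbad
  set T := (Finset.Icc 1 Q).filter fun q => 1 < q ∧ ¬ q.Prime ∧ q.Coprime a with hT
  have hcard : (Q : ℝ) * τ ≤ ε ^ 2 / 4 * (η * T.card) := by
    have := card_coprime_composites_ge h.one_lt hQ2
    calc (Q : ℝ) * τ = ε ^ 2 / 4 * (η * ((Q : ℝ) / (8 * a ^ 2))) := by rw [hτ]; ring
      _ ≤ _ := by gcongr
  refine le_trans ?_ hcard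
  have h1 : ∑ q ∈ T, modEnergy g q ≤ ∑ q ∈ T, ∑ d ∈ q.divisors.erase 1, fareyEnergy g d :=
    Finset.sum_le_sum fun q hq => modEnergy_le_sum_divisors g
      (by have := (Finset.mem_filter.1 hq).2.1; omega)
  refine h1.trans ((sum_divisors_le (fareyEnergy_nonneg g) Q a T fun q hq => ?_).trans ?_)
  · have hq' := Finset.mem_filter.1 hq
    exact ⟨by have := hq'.2.1; omega, (Finset.mem_Icc.1 hq'.1).2, hq'.2.2.2⟩
  refine mul_le_mul_of_nonneg_left ?_ (Nat.cast_nonneg Q)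
  have hsplit : ∑ d ∈ Finset.Ioc 1 Q with d.Coprime a, fareyEnergy g d / d ≤
      ∑ d ∈ Finset.Ioc 1 D₀ with d.Coprime a, fareyEnergy g d / d +
        ∑ d ∈ Finset.Ioc D₀ Q, fareyEnergy g d / d := by
    have hnn : ∀ d : ℕ, 0 ≤ fareyEnergy g d / d := fun d =>
      div_nonneg (fareyEnergy_nonneg g d) (Nat.cast_nonneg d)
    have hdisj : Disjoint ((Finset.Ioc 1 D₀).filter fun d => d.Coprime a) (Finset.Ioc D₀ Q) := by
      rw [Finset.disjoint_left]
      intro d hd hd'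
      have e1 := (Finset.mem_Ioc.1 (Finset.mem_filter.1 hd).1).2
      have e2 := (Finset.mem_Ioc.1 hd').1
      omega
    rw [← Finset.sum_union hdisj]
    refine Finset.sum_le_sum_of_subset_of_nonneg (fun d hd => ?_) fun d _ _ => hnn d
    simp only [Finset.mem_filter, Finset.mem_Ioc, Finset.mem_union] at hd ⊢
    rcases le_or_gt d D₀ with hle | hgt
    · exact Or.inl ⟨⟨hd.1.1, hle⟩, hd.2⟩
    · exact Or.inr ⟨hgt, hd.1.2⟩
  have hlow : ∑ d ∈ Finset.Ioc 1 D₀ with d.Coprime a, fareyEnergy g d / d ≤ τ / 2 := by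
    refine le_trans ?_ hK
    calc ∑ d ∈ Finset.Ioc 1 D₀ with d.Coprime a, fareyEnergy g d / d
        ≤ ∑ _d ∈ Finset.Ioc 1 D₀ with _d.Coprime a, (κ ^ K) ^ 2 := by
          refine Finset.sum_le_sum fun d hd => ?_
          rw [Finset.mem_filter, Finset.mem_Ioc] at hd
          have hd0 : (0 : ℝ) < d := by exact_mod_cast (by omega : 0 < d)
          rw [div_le_iff₀ hd0, mul_comm]
          exact hsmall κ d hd.1.1 hd.2 (hκ d (by omega) hd.1.2)
      _ = (((Finset.Ioc 1 D₀).filter fun d => d.Coprime a).card : ℝ) * (κ ^ K) ^ 2 := by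
          rw [Finset.sum_const, nsmul_eq_mul]
      _ ≤ D₀ * (κ ^ K) ^ 2 := by
          refine mul_le_mul_of_nonneg_right ?_ (by positivity)
          have : ((Finset.Ioc 1 D₀).filter fun d => d.Coprime a).card ≤ D₀ := by
            refine (Finset.card_filter_le _ _).trans ?_
            rw [Nat.card_Ioc]
            omega
          exact_mod_cast this
  have hhigh : ∑ d ∈ Finset.Ioc D₀ Q, fareyEnergy g d / d ≤ τ / 2 := by
    refine (sum_div_Ioc_le_of_le_rpow (fareyEnergy_nonneg g) hD₀pos hQ1 hC0
      fun D hD hDQ => hfarey D ((le_max_right D₁ (a ^ m₀)).trans hD)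
        ((log_natCast_le_iff (hD₀pos.trans_le hD) _).2 hDQ)).trans ?_
    calc _ ≤ C * (τ / 2 / (C + 1)) :=
          mul_le_mul_of_nonneg_left (hD₁ D₀ Q (le_max_left _ _) hQ1) hC0
      _ ≤ (C + 1) * (τ / 2 / (C + 1)) := by gcongr; linarith
      _ = τ / 2 := by field_simp
  linarith

end IsDigitWalk
end CDG

theorem theorem1p1 (a : ℕ) (ha : 1 < a) (μ : PMF ℤ) (hfin : μ.support.Finite)
    (hgcd : ∀ d : ℕ, (∀ x ∈ μ.support, ∀ y ∈ μ.support, (d : ℤ) ∣ x - y) → d = 1) :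
    Tendsto (fun n : ℕ => CDG.entropy (CDG.walkLaw a μ n) / n) atTop
        (𝓝 (CDG.entropyRate a μ)) ∧
    ∀ δ : ℝ, 0 < δ →
      (∀ ε : ℝ, 0 < ε → ∀ᶠ q : ℕ in atTop, ∀ n : ℕ,
        CDG.entropyRate a μ * n ≤ (1 - δ) * Real.log q →
          |1 / 2 * CDG.distUniform (CDG.walkLaw a μ n) q - 1| ≤ ε) ∧
      (1 / 2 * Real.log a < CDG.entropyRate a μ →
        (∀ ε : ℝ, 0 < ε → ∀ η : ℝ, 0 < η → ∀ᶠ n : ℕ in atTop,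
          (1 - η) * ((CDG.primesUpTo ((1 - δ) * CDG.entropyRate a μ * n)).ncard : ℝ) ≤
            (({q ∈ CDG.primesUpTo ((1 - δ) * CDG.entropyRate a μ * n) |
              CDG.distUniform (CDG.walkLaw a μ n) q ≤ ε}).ncard : ℝ)) ∧
        (∀ ε : ℝ, 0 < ε → ∀ η : ℝ, 0 < η → ∀ᶠ n : ℕ in atTop,
          (1 - η) *
              ((CDG.coprimeCompositesUpTo a ((1 - δ) * CDG.entropyRate a μ * n)).ncard : ℝ) ≤
            (({q ∈ CDG.coprimeCompositesUpTo a ((1 - δ) * CDG.entropyRate a μ * n) |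
              CDG.distUniform (CDG.walkLaw a μ n) q ≤ ε}).ncard : ℝ))) := by
  obtain ⟨L, h⟩ := CDG.exists_isDigitWalk a ha μ hfin
  obtain ⟨H, hH⟩ := h.exists_hasEntropyRate
  have hrate : CDG.entropyRate a μ = H := hH.tendsto.limUnder_eq
  have hgcd' : ∀ d : ℕ, (∀ x ∈ hfin.toFinset, ∀ y ∈ hfin.toFinset, (d : ℤ) ∣ x - y) → d = 1 :=
    fun d hd => hgcd d fun x hx y hy => hd x (hfin.mem_toFinset.2 hx) y (hfin.mem_toFinset.2 hy)
  -- If all digits coincided, 2 would divide every difference, against the gcd hypothesis.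
  obtain ⟨b₁, hb₁, b₂, hb₂, hne⟩ : ∃ b₁ ∈ hfin.toFinset, ∃ b₂ ∈ hfin.toFinset, b₁ ≠ b₂ := by
    by_contra hcon
    push Not at hcon
    have := hgcd' 2 fun x hx y hy => by rw [hcon x hx y hy, sub_self]; exact dvd_zero _
    omega
  rw [hrate]
  refine ⟨hH.tendsto, fun δ hδ => ⟨fun ε hε => ?_, fun hHa => ⟨fun ε hε η hη => ?_,
    fun ε hε η hη => ?_⟩⟩⟩
  · exact h.eventually_abs_half_distUniform_sub_one_le hH (h.entropyRate_pos hH hb₁ hb₂ hne) hδ hε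
  · exact h.eventually_proportion_primes hH hHa hδ hε hη
  · exact h.eventually_proportion_composites hgcd' hH hHa hδ hε hη
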